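/- Let $G$ be a connected algebraic group over $\mathbb{C}$ acting linearly (by an algebraic representation) on a finite-dimensional complex vector space $V$ with finitely many orbits. Then the dual (contragredient) action of $G$ on $V^*$ also has finitely many orbits, and the number of $G$-orbits in $V^*$ equals the number $N$ of $G$-orbits in $V$. Moreover, if $V=\bigsqcup_{i=1}^N\mathcal{O}_i$ and $V^*=\bigsqcup_{j=1}^N\mathcal{O}'_j$ are the orbit decompositions, then there is a bijection between the two sets of orbits under which $\mathcal{O}_i$ corresponds to $\mathcal{O}'_j$ if and only if $\mathbb{P}(\overline{\mathcal{O}_i})\subset\mathbb{P}(V)$ is projectively dual to $\mathbb{P}(\overline{\mathcal{O}'_j})\subset\mathbb{P}(V^*)$. Here closures are Zariski closures, and $\mathbb{P}(Y)=\{[v] : v\in Y\setminus\{0\}\}$ for $Y\subset V$ or $Y\subset V^*$. A nonempty irreducible closed subvariety $X\subset\mathbb{P}(V)$ is projectively dual to $X'\subset\mathbb{P}(V^*)$ if $X'$ is the Zariski closure of the set of all hyperplanes $H\in\mathbb{P}(V^*)$ that contain the embedded tangent space $\mathbb{P}(T_v\,\mathrm{Cone}(X))$ at some smooth point $[v]\in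 X$, where $\mathrm{Cone}(X)\subset V$ is the affine cone over $X$. By convention, $X=\emptyset$ is projectively dual to $X'=\mathbb{P}(V^*)$ only. -/

import Mathlib

open CategoryTheory MonoidalCategory AlgebraicGeometry
open scoped LinearAlgebra.Projectivization MonObj

namespace PyasetskiiDuality

noncomputable section

/-! ### Algebraic groups over `ℂ` and their linear actions

A complex algebraic group is a group object `G` in schemes over `ℂ`, of finite type. -/

/-- The group `G(ℂ)` of complex points of a group scheme `G` over `ℂ`, with the group
law induced by that of `G` (Mathlib's `Hom.group`). -/
abbrev Points (G : Over (Spec (.of ℂ))) : Type :=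
  𝟙_ (Over (Spec (.of ℂ))) ⟶ G

/-- The value `s(g) ∈ ℂ` of a global regular function `s ∈ Γ(G, ⊤)` at a complex point `g`. -/
def evalPoint {G : Over (Spec (.of ℂ))} (g : Points G) (s : Γ(G.left, ⊤)) : ℂ :=
  (Scheme.ΓSpecIso (.of ℂ)).hom (g.left.appTop s)

/-- A linear action of the complex points of `G` on a vector space `V` is algebraic (comes from a
morphism of algebraic groups `G → GL(V)`) when all its matrix coefficients `g ↦ f (g • v)`
are regular functions on `G`. -/
def IsRational {V : Type*} [AddCommGroup V] [Module ℂ V]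
    (G : Over (Spec (.of ℂ))) [GrpObj G] (ρ : Representation ℂ (Points G) V) : Prop :=
  ∀ (v : V) (f : Module.Dual ℂ V), ∃ s : Γ(G.left, ⊤), ∀ g : Points G, f (ρ g v) = evalPoint g s

/-- The set of orbits of a linear action. -/
def orbits {Γ V : Type*} [Group Γ] [AddCommGroup V] [Module ℂ V]
    (ρ : Representation ℂ Γ V) : Set (Set V) :=
  Set.range fun v : V => Set.range fun g : Γ => ρ g v

section Affine

variable {V : Type*} [AddCommGroup V] [Module ℂ V]

/-! ### Affine algebraic geometry in a vector space -/

variable (V) in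
/-- The algebra of polynomial functions on `V`, generated by the linear forms. -/
def polyFun : Subalgebra ℂ (V → ℂ) :=
  Algebra.adjoin ℂ (Set.range fun f : Module.Dual ℂ V => (f : V → ℂ))

/-- The Zariski closure of a subset of `V`. -/
def zariskiClosure (S : Set V) : Set V :=
  {v | ∀ p ∈ polyFun V, (∀ x ∈ S, p x = 0) → p v = 0}

/-- The coordinate ring `ℂ[Y]` of `Y ⊆ V`: the algebra of restrictions to `Y` of
polynomial functions. -/
def coordRing (Y : Set V) : Subalgebra ℂ (Y → ℂ) :=
  Algebra.adjoin ℂ (Set.range fun (f : Module.Dual ℂ V) (y : Y) => f y)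

/-- Evaluation `ℂ[Y] → ℂ` at a point of `Y`; its kernel is the maximal ideal of the point. -/
def evalAt (Y : Set V) (y : Y) : coordRing Y →ₐ[ℂ] ℂ :=
  (Pi.evalAlgHom ℂ (fun _ : Y => ℂ) y).comp (coordRing Y).val

instance (Y : Set V) (y : Y) : (RingHom.ker (evalAt Y y)).IsPrime :=
  RingHom.ker_isPrime _

/-- `v` is a smooth point of the (closed) subvariety `Y ⊆ V`. -/
def IsSmoothPoint (Y : Set V) (v : V) : Prop :=
  ∃ h : v ∈ Y, Algebra.IsSmoothAt ℂ (RingHom.ker (evalAt Y ⟨v, h⟩))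

/-- The Zariski tangent space `T_v Y ⊆ V`: the directions killed by the differentials at `v` of
all polynomial functions vanishing on `Y`. -/
def tangentSpace (Y : Set V) (v : V) : Set V :=
  {w | ∀ p ∈ polyFun V, (∀ y ∈ Y, p y = 0) → lineDeriv ℂ p v w = 0}

/-! ### Projective geometry -/

/-- `ℙ(Y) ⊆ ℙ(V)`: the points represented by the nonzero vectors of `Y`. -/
def projectivize (Y : Set V) : Set (ℙ ℂ V) :=
  {x | ∃ (v : V) (hv : v ≠ 0), v ∈ Y ∧ Projectivization.mk ℂ v hv = x}

/-- The affine cone over `X ⊆ ℙ(V)`, the union of `{0}` and of all lines belonging to `X`. -/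
def cone (X : Set (ℙ ℂ V)) : Set V :=
  {v | ∀ hv : v ≠ 0, Projectivization.mk ℂ v hv ∈ X}

/-- The Zariski closure of a subset of `ℙ(V)`: the common zeros of all the homogeneous
polynomials that vanish on it. -/
def projClosure (S : Set (ℙ ℂ V)) : Set (ℙ ℂ V) :=
  {x | ∀ p ∈ polyFun V, (∃ d : ℕ, ∀ (c : ℂ) (v : V), p (c • v) = c ^ d * p v) →
    (∀ y ∈ S, p y.rep = 0) → p x.rep = 0}

/-- The hyperplane `H ⊆ ℙ(V)`, a point of `ℙ(V*)`, is tangent to `X ⊆ ℙ(V)`: it contains the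
embedded tangent space `ℙ(T_v (cone X))` at some smooth point `[v]` of `X`. Here `[v]` is a
smooth point of `X` exactly when `v ≠ 0` is a smooth point of the cone. -/
def IsTangentHyperplane (X : Set (ℙ ℂ V)) (H : ℙ ℂ (Module.Dual ℂ V)) : Prop :=
  ∃ v : V, v ≠ 0 ∧ IsSmoothPoint (cone X) v ∧
    ∀ f ∈ H.submodule, ∀ w ∈ tangentSpace (cone X) v, f w = 0

/-- The dual variety `X* ⊆ ℙ(V*)` of a (nonempty, irreducible, closed) `X ⊆ ℙ(V)`: the Zariski
closure of the set of all tangent hyperplanes. -/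
def dualVariety (X : Set (ℙ ℂ V)) : Set (ℙ ℂ (Module.Dual ℂ V)) :=
  projClosure {H | IsTangentHyperplane X H}

/-- `X ⊆ ℙ(V)` is projectively dual to `X' ⊆ ℙ(V*)`. The empty set has no tangent hyperplanes in
the sense above; by convention it is dual to the whole space `ℙ(V*)` (just as the definition
makes `ℙ(V)` dual to the empty set). -/
def IsProjectivelyDual (X : Set (ℙ ℂ V)) (X' : Set (ℙ ℂ (Module.Dual ℂ V))) : Prop :=
  (X = ∅ ∧ X' = Set.univ) ∨ (X.Nonempty ∧ dualVariety X = X')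

end Affine

end

end PyasetskiiDuality

namespace PyasetskiiDuality

/-! ### Generic smoothness, lifting of tangent vectors and images of dominant morphisms -/

/-! Write `U` for the dual space `V*`. For `x` in `V` and `ξ` in `U`, say that the pair is conormal
if `ξ` kills the tangent space at `x` of the orbit of `x`. That tangent space consists of the
velocities `X x`, with `X` tangent at `1` to the image of the group. Differentiating the invariance
of the pairing gives `⟨X x, ξ⟩ + ⟨x, X ξ⟩ = 0`, so the condition is symmetric in `V` and `U`
(`mem_annihilator_orbit_iff`). The conormal pairs are therefore partitioned in two ways: by conormal
bundles of orbits in `V`, and by those of orbits in `U`.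

Each conormal bundle is irreducible (`isIrred_conormal`), with tangent spaces of dimension `dim V`
(`finrank_tangentSubmodule_conormal`). When `V` has finitely many orbits, the bundle of an orbit in
`U` is covered by finitely many bundles from `V`. One of these contains a dense part of it, and
equality of dimensions forces equal closures (`exists_vanishing_conormal_eq`). The two projections
recover the closures of both orbits, and an orbit is determined by its closure because it contains a
nonempty open subset of it (`IsRegularMap.exists_mem_range`). Hence the orbits of `U` inject into
those of `V` and are finite in number; exchanging the roles gives the inverse map. Projecting the
conormal bundle of `O` to `U` yields the cone over the dual variety of the projectivized closure of
`O` (`IsIrred.dualVariety_eq`).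

No dimension theory is used: at a smooth point, an irreducible overset with the same tangent space
has the same closure (`vanishing_subset_of_tangentSpace_subset`). Closures are compared through the
functions vanishing on the sets. The group is mapped into the algebra `End V × End U`, so that all
orbit maps are restrictions of linear maps. -/

/-- Generic smoothness of a dominant morphism of integral schemes in characteristic zero. -/
theorem exists_ne_zero_smooth_away (B A : Type*) [CommRing B] [CommRing A] [IsDomain B]
    [IsDomain A] [CharZero B] [IsNoetherianRing B] [Algebra B A] [Algebra.FiniteType B A]
    (hinj : Function.Injective (algebraMap B A)) :
    ∃ f : A, f ≠ 0 ∧ Algebra.Smooth B (Localization.Away f) := by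
  have : Algebra.FinitePresentation B A := Algebra.FinitePresentation.of_finiteType.mp inferInstance
  have : FaithfulSMul B A := (faithfulSMul_iff_algebraMap_injective B A).mpr hinj
  -- The fraction field is taken as the localization at `⊥`, so that its smoothness over `B` is
  -- smoothness at the generic point.
  let K := Localization.AtPrime (⊥ : Ideal A)
  have hK : IsFractionRing A K := by
    have : (⊥ : Ideal A).primeCompl = nonZeroDivisors A := by
      ext x; simp [Ideal.primeCompl]
    change IsLocalization (nonZeroDivisors A) K
    rw [← this]; infer_instance
  let : Field K := IsFractionRing.toField A
  let L := FractionRing B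
  have : FaithfulSMul B K := by
    rw [faithfulSMul_iff_algebraMap_injective, IsScalarTower.algebraMap_eq B A K]
    exact (IsFractionRing.injective A K).comp hinj
  let : Algebra L K := FractionRing.liftAlgebra B K
  have : IsScalarTower B L K := FractionRing.isScalarTower_liftAlgebra B K
  have : CharZero L := charZero_of_injective_algebraMap (IsFractionRing.injective B L)
  have : Algebra.EssFiniteType A K := Algebra.EssFiniteType.of_isLocalization _ (⊥ : Ideal A).primeCompl
  have : Algebra.EssFiniteType B K := Algebra.EssFiniteType.comp B A K
  have : Algebra.EssFiniteType L K := Algebra.EssFiniteType.of_comp B L K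
  -- Characteristic zero enters here, through perfectness of `L`.
  have : Algebra.FormallySmooth L K := Algebra.FormallySmooth.of_perfectField
  have : Algebra.FormallySmooth B L := Algebra.FormallySmooth.of_isLocalization (nonZeroDivisors B)
  have : Algebra.FormallySmooth B K := Algebra.FormallySmooth.comp B L K
  have : Algebra.IsSmoothAt B (⊥ : Ideal A) := this
  obtain ⟨f, hf, h⟩ := Algebra.IsSmoothAt.exists_notMem_smooth B (⊥ : Ideal A)
  exact ⟨f, by simpa using hf, h⟩

/-- Infinitesimal lifting along a localization that is smooth over the base. -/
theorem exists_lift_of_smooth_away {B A C D : Type*} [CommRing B] [CommRing A] [CommRing C]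
    [CommRing D] [Algebra B A] {f : A} (hf : Algebra.Smooth B (Localization.Away f))
    (π : D →+* C) (hπ : Function.Surjective π) (hker : IsNilpotent (RingHom.ker π))
    (ψ : B →+* D) (χ : A →+* C) (hχ : χ.comp (algebraMap B A) = π.comp ψ) (hu : IsUnit (χ f)) :
    ∃ φ : A →+* D, π.comp φ = χ ∧ φ.comp (algebraMap B A) = ψ := by
  let : Algebra B D := ψ.toAlgebra
  let : Algebra B C := (π.comp ψ).toAlgebra
  let g : D →ₐ[B] C := { π with commutes' := fun _ => rfl }
  let χ' : A →ₐ[B] C := { χ with commutes' := fun b => congr($hχ b) }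
  have hu' : ∀ y : Submonoid.powers f, IsUnit (χ' y) := by
    rintro ⟨_, n, rfl⟩
    exact (map_pow χ f n) ▸ hu.pow n
  let χf : Localization.Away f →ₐ[B] C := IsLocalization.liftAlgHom (M := Submonoid.powers f) hu'
  let Φ := Algebra.FormallySmooth.liftOfSurjective χf g hπ hker
  refine ⟨(Φ : Localization.Away f →+* D).comp (algebraMap A _), ?_, ?_⟩
  · ext a
    have := Algebra.FormallySmooth.liftOfSurjective_apply χf g hπ hker (algebraMap A _ a)
    change π _ = _ at this
    simp only [RingHom.coe_comp, Function.comp_apply]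
    refine this.trans ?_
    simp [χf, χ']
  · ext b
    have := Φ.commutes b
    simp only [RingHom.coe_comp, Function.comp_apply, ← IsScalarTower.algebraMap_apply]
    exact this

/-- A nonzero algebra of finite type over an algebraically closed field has a rational point. -/
theorem exists_algHom_of_finiteType (k A : Type*) [Field k] [IsAlgClosed k] [CommRing A]
    [Algebra k A] [Algebra.FiniteType k A] [Nontrivial A] : Nonempty (A →ₐ[k] k) := by
  obtain ⟨m, hm⟩ := Ideal.exists_maximal A
  let : Field (A ⧸ m) := Ideal.Quotient.field m
  have : Algebra.FiniteType k (A ⧸ m) := inferInstance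
  have : Module.Finite k (A ⧸ m) := finite_of_finite_type_of_isJacobsonRing k (A ⧸ m)
  have hb := IsAlgClosed.algebraMap_bijective_of_isIntegral (k := k) (K := A ⧸ m)
  exact ⟨((AlgEquiv.ofBijective (Algebra.ofId k (A ⧸ m)) hb).symm : (A ⧸ m) →ₐ[k] k).comp
    (Ideal.Quotient.mkₐ k m)⟩

/-- Rabinowitsch trick: if `a` is not nilpotent, inverting it gives a nonzero algebra, which has a
rational point, and `a` does not vanish there. -/
theorem eq_zero_of_forall_algHom {k A : Type*} [Field k] [IsAlgClosed k] [CommRing A]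
    [Algebra k A] [Algebra.FiniteType k A] [IsReduced A] {a : A}
    (h : ∀ χ : A →ₐ[k] k, χ a = 0) : a = 0 := by
  by_contra ha
  have hn : ¬ IsNilpotent a := fun h => ha h.eq_zero
  have : Nontrivial (Localization.Away a) := by
    rw [← not_subsingleton_iff_nontrivial]
    intro hs
    have := (IsLocalization.Away.algebraMap_isUnit (S := Localization.Away a) a)
    have h0 := (IsLocalization.subsingleton_iff (S := Localization.Away a) (M := Submonoid.powers a)).mp hs
    obtain ⟨n, hn'⟩ := h0
    exact hn ⟨n, hn'⟩
  have : Algebra.FiniteType A (Localization.Away a) := inferInstance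
  have : Algebra.FiniteType k (Localization.Away a) := Algebra.FiniteType.trans (S := A) inferInstance this
  obtain ⟨χ⟩ := exists_algHom_of_finiteType k (Localization.Away a)
  have h1 := h (χ.comp (IsScalarTower.toAlgHom k A _))
  have h2 := (IsLocalization.Away.algebraMap_isUnit (S := Localization.Away a) a).map χ
  simp at h1
  rw [h1] at h2
  exact not_isUnit_zero h2

/-- The image of a dominant morphism of affine varieties contains a nonempty open subset. -/
theorem exists_ne_zero_forall_algHom_extends (k B A : Type*) [Field k] [IsAlgClosed k] [CharZero k]
    [CommRing B] [CommRing A] [IsDomain B] [IsDomain A] [Algebra k B] [Algebra k A] [Algebra B A]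
    [IsScalarTower k B A] [Algebra.FiniteType k B] [Algebra.FiniteType k A]
    (hinj : Function.Injective (algebraMap B A)) :
    ∃ b : B, b ≠ 0 ∧ ∀ ψ : B →ₐ[k] k, ψ b ≠ 0 →
      ∃ χ : A →ₐ[k] k, ∀ x, χ (algebraMap B A x) = ψ x := by
  have : CharZero B := charZero_of_injective_algebraMap (FaithfulSMul.algebraMap_injective k B)
  have : IsNoetherianRing B := Algebra.FiniteType.isNoetherianRing k B
  have : Algebra.FiniteType B A := Algebra.FiniteType.of_restrictScalars_finiteType k B A
  obtain ⟨f, hf, hs⟩ := exists_ne_zero_smooth_away B A hinj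
  let Af := Localization.Away f
  have : Algebra.FinitePresentation B Af := inferInstance
  have : Module.Flat B Af := inferInstance
  have : IsDomain Af := IsLocalization.isDomain_localization (powers_le_nonZeroDivisors_of_noZeroDivisors hf)
  -- A flat map of finite presentation is open on spectra. The image contains the generic point,
  -- hence a basic open set `D(b)`; over a point of `D(b)` the fibre ring is nonzero and so has a
  -- rational point.
  have hopen := PrimeSpectrum.isOpenMap_comap_of_hasGoingDown_of_finitePresentation (R := B) (S := Af)
  have ho := hopen _ isOpen_univ
  have hmem : (⊥ : PrimeSpectrum B) ∈ (PrimeSpectrum.comap (algebraMap B Af)) '' Set.univ := by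
    refine ⟨⊥, trivial, ?_⟩
    ext x
    have h1 : Function.Injective (algebraMap B Af) := by
      rw [IsScalarTower.algebraMap_eq B A Af]
      exact (IsLocalization.injective Af (powers_le_nonZeroDivisors_of_noZeroDivisors hf)).comp hinj
    simp [PrimeSpectrum.comap]
  obtain ⟨_, ⟨_, ⟨b, rfl⟩, rfl⟩, hb, hb'⟩ :=
    PrimeSpectrum.isBasis_basic_opens.exists_subset_of_mem_open hmem ho
  refine ⟨b, fun h => by simp [h] at hb, fun ψ hψ => ?_⟩
  let y : PrimeSpectrum B := ⟨RingHom.ker ψ, RingHom.ker_isPrime _⟩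
  obtain ⟨P, -, hP⟩ := hb' (show y ∈ _ from hψ)
  have hne : (RingHom.ker ψ).map (algebraMap B Af) ≠ ⊤ := by
    intro htop
    have : (RingHom.ker ψ).map (algebraMap B Af) ≤ P.asIdeal := by
      rw [Ideal.map_le_iff_le_comap]
      exact congr($(hP).asIdeal).ge
    rw [htop] at this
    exact P.2.ne_top (top_le_iff.mp this)
  have : Nontrivial (Af ⧸ (RingHom.ker ψ).map (algebraMap B Af)) := Ideal.Quotient.nontrivial_iff.mpr hne
  have : Algebra.FiniteType A Af := inferInstance
  have : Algebra.FiniteType k Af := Algebra.FiniteType.trans (S := A) inferInstance this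
  obtain ⟨χ⟩ := exists_algHom_of_finiteType k (Af ⧸ (RingHom.ker ψ).map (algebraMap B Af))
  let e : A →ₐ[k] k := (χ.comp (Ideal.Quotient.mkₐ k _)).comp (IsScalarTower.toAlgHom k A Af)
  refine ⟨e, fun x => ?_⟩
  have hx : x - algebraMap k B (ψ x) ∈ RingHom.ker ψ := by simp [RingHom.mem_ker]
  have h1 : e (algebraMap B A (x - algebraMap k B (ψ x))) = 0 := by
    have := Ideal.mem_map_of_mem (algebraMap B Af) hx
    rw [← Ideal.Quotient.eq_zero_iff_mem] at this
    simp only [e, AlgHom.comp_apply, IsScalarTower.coe_toAlgHom', ← IsScalarTower.algebraMap_apply,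
      Ideal.Quotient.mkₐ_eq_mk]
    rw [this, map_zero]
  rw [map_sub, map_sub, ← IsScalarTower.algebraMap_apply k B A, AlgHom.commutes, sub_eq_zero] at h1
  exact h1

/-- A surjection from a domain onto a `k`-algebra that is smooth at a rational point is injective
as soon as every tangent vector of the source at that point is tangent to the target. -/
theorem eq_zero_of_isSmoothAt {k R' R : Type*} [Field k] [CommRing R'] [CommRing R] [Algebra k R']
    [Algebra k R] [IsDomain R'] [IsNoetherianRing R'] (π : R' →ₐ[k] R)
    (hπ : Function.Surjective π) (χ : R →ₐ[k] k) [(RingHom.ker χ).IsPrime]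
    (hs : Algebra.IsSmoothAt k (RingHom.ker χ))
    (h : ∀ φ : R' →ₐ[k] DualNumber k, (∀ r, (φ r).fst = χ (π r)) → ∀ r, π r = 0 → φ r = 0)
    {r : R'} (hr : π r = 0) : r = 0 := by
  have hprime : (RingHom.ker (χ.comp π)).IsPrime := RingHom.ker_isPrime _
  let S := Localization.AtPrime (RingHom.ker (χ.comp π))
  let P := Localization.AtPrime (RingHom.ker χ)
  let ψ : R' →ₐ[k] P := (IsScalarTower.toAlgHom k R P).comp π
  let F : S →ₐ[k] P := IsLocalization.liftAlgHom (M := (RingHom.ker (χ.comp π)).primeCompl)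
    (f := ψ) (fun y => IsLocalization.map_units (M := (RingHom.ker χ).primeCompl) P
      ⟨π y, fun h => y.2 h⟩)
  have hF (x : R') : F (algebraMap R' S x) = algebraMap R P (π x) := by
    exact IsLocalization.lift_eq (M := (RingHom.ker (χ.comp π)).primeCompl) _ x
  let χP : P →ₐ[k] k := IsLocalization.liftAlgHom (M := (RingHom.ker χ).primeCompl)
    (f := χ) (fun y => isUnit_iff_ne_zero.mpr fun h => y.2 h)
  have hχP (x : R) : χP (algebraMap R P x) = χ x := by simp [χP]
  have hFs : Function.Surjective F := by
    intro z
    obtain ⟨⟨x, y⟩, hxy⟩ := IsLocalization.surj (RingHom.ker χ).primeCompl z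
    obtain ⟨x', rfl⟩ := hπ x
    obtain ⟨y', hy'⟩ := hπ y
    have hyc : y' ∈ (RingHom.ker (χ.comp π)).primeCompl := fun h => y.2 (by
      rw [← hy']; exact h)
    refine ⟨IsLocalization.mk' S x' ⟨y', hyc⟩, ?_⟩
    have hu : IsUnit (algebraMap R P y) := IsLocalization.map_units P y
    rw [← hu.mul_left_inj]
    simp only at hxy
    rw [hxy, ← hF, ← hy', ← hF, ← map_mul]
    congr 1
    exact IsLocalization.mk'_spec S x' ⟨y', hyc⟩
  let n : Ideal S := RingHom.ker (χP.comp F)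
  let I : Ideal S := RingHom.ker F
  have hIn : I ≤ n := fun x hx => by
    have : F x = 0 := hx
    simp [n, RingHom.mem_ker, this]
  -- Modulo `J = nI` the kernel `I` has square zero and `S` acts on it through `k`. Smoothness of
  -- `P` gives a section `σ` of `S ⧸ J → P`. Composed with a linear form, the defect `s - σ (F s)`
  -- is a derivation at the point, that is, a tangent vector of the source. The hypothesis makes it
  -- vanish on the kernel of `π`, so `I ≤ nI`, and Nakayama gives `I = 0`.
  let J : Ideal S := n * I
  let q : (S ⧸ J) →ₐ[k] P := Ideal.Quotient.liftₐ J F fun x hx =>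
    (Ideal.mul_le.mpr fun a _ b hb => I.mul_mem_left a hb : J ≤ I) hx
  have hq : Function.Surjective q := fun z => by
    obtain ⟨s, rfl⟩ := hFs z
    exact ⟨Ideal.Quotient.mk J s, rfl⟩
  have hact (s : S) (y : S ⧸ J) (hy : q y = 0) :
      Ideal.Quotient.mk J s * y = algebraMap k _ (χP (F s)) * y := by
    obtain ⟨x, rfl⟩ := Ideal.Quotient.mk_surjective y
    rw [← sub_eq_zero, ← sub_mul]
    have : (algebraMap k (S ⧸ J)) (χP (F s)) = Ideal.Quotient.mk J (algebraMap k S (χP (F s))) := rfl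
    rw [this, ← map_sub, ← map_mul, Ideal.Quotient.eq_zero_iff_mem]
    refine Ideal.mul_mem_mul ?_ hy
    simp [n, RingHom.mem_ker]
  have hsq (y y' : S ⧸ J) (hy : q y = 0) (hy' : q y' = 0) : y * y' = 0 := by
    obtain ⟨x, rfl⟩ := Ideal.Quotient.mk_surjective y
    have : F x = 0 := hy
    rw [hact x y' hy', this]
    simp
  have hnil : IsNilpotent (RingHom.ker (q : (S ⧸ J) →+* P)) := by
    refine ⟨2, ?_⟩
    refine (pow_two (RingHom.ker (q : (S ⧸ J) →+* P))).trans ?_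
    rw [Ideal.zero_eq_bot, eq_bot_iff, Ideal.mul_le]
    exact fun a ha b hb => hsq a b ha hb
  let σ : P →ₐ[k] (S ⧸ J) :=
    Algebra.FormallySmooth.liftOfSurjective (AlgHom.id k P) q hq hnil
  have hσ (z : P) : q (σ z) = z :=
    Algebra.FormallySmooth.liftOfSurjective_apply (AlgHom.id k P) q hq hnil z
  have hdiff (s : S) : q (Ideal.Quotient.mk J s - σ (F s)) = 0 := by
    rw [map_sub, hσ, sub_eq_zero]; rfl
  have key (x : R') (hx : π x = 0) : algebraMap R' S x ∈ J := by
    rw [← Ideal.Quotient.eq_zero_iff_mem]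
    by_contra hne
    obtain ⟨l, hl⟩ : ∃ l : Module.Dual k (S ⧸ J), l (Ideal.Quotient.mk J (algebraMap R' S x)) ≠ 0 := by
      by_contra! hl
      exact hne ((Module.forall_dual_apply_eq_zero_iff k _).mp hl)
    let d : R' →ₗ[k] k := l ∘ₗ
      (((Ideal.Quotient.mkₐ k J).comp (IsScalarTower.toAlgHom k R' S)).toLinearMap -
        (σ.comp (F.comp (IsScalarTower.toAlgHom k R' S))).toLinearMap)
    have hd (x : R') : d x = l (Ideal.Quotient.mk J (algebraMap R' S x)
      - σ (F (algebraMap R' S x))) := rfl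
    have hmul (a b : R') : d (a * b) = χ (π a) * d b + χ (π b) * d a := by
      have e1 : Ideal.Quotient.mk J (algebraMap R' S (a * b)) - σ (F (algebraMap R' S (a * b))) =
          (χ (π a)) • (Ideal.Quotient.mk J (algebraMap R' S b) - σ (F (algebraMap R' S b))) +
          (χ (π b)) • (Ideal.Quotient.mk J (algebraMap R' S a) - σ (F (algebraMap R' S a))) := by
        have ha := hact (algebraMap R' S a) _ (hdiff (algebraMap R' S b))
        have hb := hact (algebraMap R' S b) _ (hdiff (algebraMap R' S a))
        have hab := hsq _ _ (hdiff (algebraMap R' S a)) (hdiff (algebraMap R' S b))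
        simp only [hF, hχP] at ha hb hab
        rw [Algebra.smul_def, Algebra.smul_def]
        simp only [map_mul, hF]
        -- With `δ` the defect, `ab - σ(a)σ(b) = a δb + b δa - δa δb`, and the last product is zero.
        linear_combination ha + hb - hab
      rw [hd, e1, map_add, map_smul, map_smul, ← hd, ← hd]
      rfl
    have hone : d 1 = 0 := by
      have := hmul 1 1
      simpa using this
    let φ : R' →ₐ[k] DualNumber k := AlgHom.ofLinearMap
      ((TrivSqZeroExt.inlAlgHom k k k).toLinearMap ∘ₗ (χ.comp π).toLinearMap +
        (TrivSqZeroExt.inrHom k k) ∘ₗ d)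
      (by ext <;> simp [hone]) (by
        intro a b
        ext
        · simp
        · simp [hmul]; ring)
    have h0 := h φ (fun r => by simp [φ]) x hx
    have h1 : d x = 0 := by
      have := congr_arg TrivSqZeroExt.snd h0
      simpa [φ] using this
    apply hl
    rw [hd, hF, hx] at h1
    simpa using h1
  have hIJ : I ≤ n • I := by
    intro z hz
    obtain ⟨⟨x, y⟩, hxy⟩ := IsLocalization.surj (RingHom.ker (χ.comp π)).primeCompl z
    have hz0 : F z = 0 := hz
    have h1 : algebraMap R P (π x) = 0 := by
      rw [← hF]
      simp only at hxy
      rw [← hxy, map_mul, hz0, zero_mul]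
    obtain ⟨⟨c, hc⟩, hc'⟩ := (IsLocalization.map_eq_zero_iff (RingHom.ker χ).primeCompl P _).mp h1
    obtain ⟨c', rfl⟩ := hπ c
    have hcc : c' ∈ (RingHom.ker (χ.comp π)).primeCompl := hc
    have h2 := key (c' * x) (by simpa using hc')
    have hu : IsUnit (algebraMap R' S (c' * y)) :=
      IsLocalization.map_units S ((⟨c', hcc⟩ * y : (RingHom.ker (χ.comp π)).primeCompl))
    have h3 : z * algebraMap R' S (c' * y) ∈ J := by
      have : z * algebraMap R' S (c' * y) = algebraMap R' S (c' * x) := by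
        simp only at hxy
        rw [map_mul, map_mul, ← hxy]; ring
      rwa [this]
    exact (Ideal.unit_mul_mem_iff_mem J hu).mp (by rwa [mul_comm] at h3)
  have hSN : IsNoetherianRing S := IsLocalization.isNoetherianRing (RingHom.ker (χ.comp π)).primeCompl S inferInstance
  have hn : n ≤ (⊥ : Ideal S).jacobson := by
    rw [IsLocalRing.jacobson_eq_maximalIdeal _ bot_ne_top]
    exact IsLocalRing.le_maximalIdeal (RingHom.ker_ne_top _)
  have hI : I = ⊥ := Submodule.eq_bot_of_le_smul_of_le_jacobson_bot n I (IsNoetherian.noetherian I) hIJ hn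
  have : algebraMap R' S r ∈ I := by
    change F _ = 0
    rw [hF, hr, map_zero]
  rw [hI, Ideal.mem_bot] at this
  exact (map_eq_zero_iff _ (IsLocalization.injective S
    (RingHom.ker (χ.comp π)).primeCompl_le_nonZeroDivisors)).mp this

/-! ### Polynomial functions and tangent spaces -/

section PolyFun

variable {V W : Type*} [AddCommGroup V] [Module ℂ V] [AddCommGroup W] [Module ℂ W]

theorem dual_mem_polyFun (f : Module.Dual ℂ V) : (f : V → ℂ) ∈ polyFun V :=
  Algebra.subset_adjoin ⟨f, rfl⟩

theorem const_mem_polyFun (c : ℂ) : (fun _ : V => c) ∈ polyFun V :=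
  (polyFun V).algebraMap_mem c

theorem comp_affine_mem_polyFun {p : V → ℂ} (hp : p ∈ polyFun V) (l : W →ₗ[ℂ] V) (c : V) :
    (fun w => p (l w + c)) ∈ polyFun W := by
  induction hp using Algebra.adjoin_induction with
  | mem x hx =>
    obtain ⟨f, rfl⟩ := hx
    simp only [map_add]
    exact (polyFun W).add_mem (dual_mem_polyFun (f ∘ₗ l)) (const_mem_polyFun (f c))
  | algebraMap r => exact const_mem_polyFun r
  | add x y _ _ hx hy => exact (polyFun W).add_mem hx hy
  | mul x y _ _ hx hy => exact (polyFun W).mul_mem hx hy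

theorem comp_linear_mem_polyFun {p : V → ℂ} (hp : p ∈ polyFun V) (l : W →ₗ[ℂ] V) :
    (fun w => p (l w)) ∈ polyFun W := by
  simpa using comp_affine_mem_polyFun hp l 0

theorem bilin_mem_polyFun {U : Type*} [AddCommGroup U] [Module ℂ U] [FiniteDimensional ℂ V]
    (B : V →ₗ[ℂ] U →ₗ[ℂ] ℂ) (l : W →ₗ[ℂ] V) (l' : W →ₗ[ℂ] U) :
    (fun w => B (l w) (l' w)) ∈ polyFun W := by
  let b := Module.finBasis ℂ V
  have : (fun w => B (l w) (l' w)) =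
      ∑ i, ((b.coord i ∘ₗ l : Module.Dual ℂ W) : W → ℂ) * ((B (b i) ∘ₗ l' : Module.Dual ℂ W) : W → ℂ) := by
    ext w
    conv_lhs => rw [← b.sum_repr (l w)]
    simp only [map_sum, map_smul, LinearMap.sum_apply, LinearMap.smul_apply, Finset.sum_apply,
      Pi.mul_apply, LinearMap.comp_apply, Module.Basis.coord_apply, smul_eq_mul]
  rw [this]
  exact (polyFun W).sum_mem fun i _ => (polyFun W).mul_mem (dual_mem_polyFun _) (dual_mem_polyFun _)

/-- `V` carries no topology, so derivatives are taken along lines; linearity in the direction is not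
automatic and is carried through the induction. -/
theorem exists_dual_hasLineDerivAt {p : V → ℂ} (hp : p ∈ polyFun V) (v : V) :
    ∃ D : Module.Dual ℂ V, ∀ w, HasLineDerivAt ℂ p (D w) v w := by
  induction hp using Algebra.adjoin_induction with
  | mem x hx =>
    obtain ⟨f, rfl⟩ := hx
    refine ⟨f, fun w => ?_⟩
    have : HasDerivAt (fun t : ℂ => f v + t * f w) (1 * f w) 0 :=
      ((hasDerivAt_id (0 : ℂ)).mul_const (f w)).const_add (f v)
    simpa [HasLineDerivAt] using this
  | algebraMap r => exact ⟨0, fun w => hasDerivAt_const (0 : ℂ) r⟩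
  | add x y _ _ hx hy =>
    obtain ⟨D, hD⟩ := hx
    obtain ⟨E, hE⟩ := hy
    exact ⟨D + E, fun w => HasDerivAt.add (hD w) (hE w)⟩
  | mul x y _ _ hx hy =>
    obtain ⟨D, hD⟩ := hx
    obtain ⟨E, hE⟩ := hy
    refine ⟨y v • D + x v • E, fun w => ?_⟩
    refine HasDerivAt.congr_deriv (HasDerivAt.mul (hD w) (hE w)) ?_
    simp [mul_comm]

theorem hasLineDerivAt_of_mem_polyFun {p : V → ℂ} (hp : p ∈ polyFun V) (v w : V) :
    HasLineDerivAt ℂ p (lineDeriv ℂ p v w) v w := by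
  obtain ⟨D, hD⟩ := exists_dual_hasLineDerivAt hp v
  rw [(hD w).lineDeriv]
  exact hD w

/-- The differential at `v` of a polynomial function. -/
noncomputable def differential {p : V → ℂ} (hp : p ∈ polyFun V) (v : V) : Module.Dual ℂ V :=
  (exists_dual_hasLineDerivAt hp v).choose

theorem differential_apply {p : V → ℂ} (hp : p ∈ polyFun V) (v w : V) :
    differential hp v w = lineDeriv ℂ p v w :=
  ((exists_dual_hasLineDerivAt hp v).choose_spec w).lineDeriv.symm

theorem lineDeriv_dual (f : Module.Dual ℂ V) (v w : V) : lineDeriv ℂ f v w = f w := by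
  have : HasDerivAt (fun t : ℂ => f v + t * f w) (1 * f w) 0 :=
    ((hasDerivAt_id (0 : ℂ)).mul_const (f w)).const_add (f v)
  refine HasLineDerivAt.lineDeriv ?_
  simpa [HasLineDerivAt] using this

theorem lineDeriv_polyFun_mul {p q : V → ℂ} (hp : p ∈ polyFun V) (hq : q ∈ polyFun V) (v w : V) :
    lineDeriv ℂ (p * q) v w = p v * lineDeriv ℂ q v w + lineDeriv ℂ p v w * q v := by
  refine HasLineDerivAt.lineDeriv ?_
  refine HasDerivAt.congr_deriv (HasDerivAt.mul (hasLineDerivAt_of_mem_polyFun hp v w)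
    (hasLineDerivAt_of_mem_polyFun hq v w)) ?_
  simp [add_comm]

theorem lineDeriv_polyFun_add {p q : V → ℂ} (hp : p ∈ polyFun V) (hq : q ∈ polyFun V) (v w : V) :
    lineDeriv ℂ (p + q) v w = lineDeriv ℂ p v w + lineDeriv ℂ q v w :=
  HasLineDerivAt.lineDeriv <|
    HasDerivAt.add (hasLineDerivAt_of_mem_polyFun hp v w) (hasLineDerivAt_of_mem_polyFun hq v w)

theorem lineDeriv_mem_polyFun {p : V → ℂ} (hp : p ∈ polyFun V) (w : V) :
    (fun v => lineDeriv ℂ p v w) ∈ polyFun V := by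
  induction hp using Algebra.adjoin_induction with
  | mem x hx =>
    obtain ⟨f, rfl⟩ := hx
    simp only [lineDeriv_dual]
    exact const_mem_polyFun (f w)
  | algebraMap r =>
    have : (fun v : V => lineDeriv ℂ (algebraMap ℂ (V → ℂ) r) v w) = fun _ => 0 := by
      ext v
      exact (hasDerivAt_const (0 : ℂ) r).deriv
    rw [this]
    exact const_mem_polyFun 0
  | add x y hx' hy' hx hy =>
    simp only [lineDeriv_polyFun_add hx' hy']
    exact (polyFun V).add_mem hx hy
  | mul x y hx' hy' hx hy =>
    simp only [lineDeriv_polyFun_mul hx' hy']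
    exact (polyFun V).add_mem ((polyFun V).mul_mem hx' hy) ((polyFun V).mul_mem hx hy')

/-- The polynomial functions vanishing on `M`. -/
def vanishing (M : Set V) : Set (V → ℂ) := {p | p ∈ polyFun V ∧ ∀ x ∈ M, p x = 0}

theorem vanishing_anti {M N : Set V} (h : M ⊆ N) : vanishing N ⊆ vanishing M :=
  fun _ hp => ⟨hp.1, fun x hx => hp.2 x (h hx)⟩

theorem mem_zariskiClosure {M : Set V} {v : V} :
    v ∈ zariskiClosure M ↔ ∀ p ∈ vanishing M, p v = 0 :=
  ⟨fun h p hp => h p hp.1 hp.2, fun h p hp hp' => h p ⟨hp, hp'⟩⟩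

theorem mem_tangentSpace {M : Set V} {v w : V} :
    w ∈ tangentSpace M v ↔ ∀ p ∈ vanishing M, lineDeriv ℂ p v w = 0 :=
  ⟨fun h p hp => h p hp.1 hp.2, fun h p hp hp' => h p ⟨hp, hp'⟩⟩

theorem tangentSpace_congr {M N : Set V} (h : vanishing M = vanishing N) (v : V) :
    tangentSpace M v = tangentSpace N v := by
  ext w; rw [mem_tangentSpace, mem_tangentSpace, h]

theorem tangentSpace_mono {M N : Set V} (h : vanishing N ⊆ vanishing M) (v : V) :
    tangentSpace M v ⊆ tangentSpace N v := fun _ hw =>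
  mem_tangentSpace.mpr fun p hp => mem_tangentSpace.mp hw p (h hp)

theorem zariskiClosure_congr {M N : Set V} (h : vanishing M = vanishing N) :
    zariskiClosure M = zariskiClosure N := by
  ext w; rw [mem_zariskiClosure, mem_zariskiClosure, h]

theorem subset_zariskiClosure (M : Set V) : M ⊆ zariskiClosure M := fun _ hx _ _ h => h _ hx

theorem vanishing_zariskiClosure (M : Set V) : vanishing (zariskiClosure M) = vanishing M :=
  (vanishing_anti (subset_zariskiClosure M)).antisymm
    fun _ hp => ⟨hp.1, fun _ hx => mem_zariskiClosure.mp hx _ hp⟩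

theorem zariskiClosure_eq_iff {M N : Set V} :
    zariskiClosure M = zariskiClosure N ↔ vanishing M = vanishing N :=
  ⟨fun h => by rw [← vanishing_zariskiClosure M, h, vanishing_zariskiClosure], zariskiClosure_congr⟩

/-- The tangent space as a linear subspace. -/
noncomputable def tangentSubmodule (M : Set V) (v : V) : Submodule ℂ V where
  carrier := tangentSpace M v
  add_mem' {a b} ha hb p hp h := by
    rw [← differential_apply hp, map_add, differential_apply, differential_apply, ha p hp h,
      hb p hp h, add_zero]
  zero_mem' p hp _ := by rw [← differential_apply hp, map_zero]
  smul_mem' c a ha p hp h := by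
    rw [← differential_apply hp, map_smul, differential_apply, ha p hp h, smul_zero]

theorem lineDeriv_comp_linear {p : V → ℂ} (l : W →ₗ[ℂ] V) (m w : W) :
    lineDeriv ℂ (fun x => p (l x)) m w = lineDeriv ℂ p (l m) (l w) := by
  simp [lineDeriv]

theorem map_mem_tangentSpace {M : Set W} {N : Set V} (l : W →ₗ[ℂ] V) (h : Set.MapsTo l M N)
    {m w : W} (hw : w ∈ tangentSpace M m) : l w ∈ tangentSpace N (l m) := by
  intro p hp hpN
  rw [← lineDeriv_comp_linear]
  exact hw _ (comp_linear_mem_polyFun hp l) fun x hx => hpN _ (h hx)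

/-- A set is irreducible when its coordinate ring is a domain. -/
structure IsIrred (M : Set V) : Prop where
  nonempty : M.Nonempty
  eq_zero_or {p q : V → ℂ} : p ∈ polyFun V → q ∈ polyFun V → p * q ∈ vanishing M →
    p ∈ vanishing M ∨ q ∈ vanishing M

theorem IsIrred.congr {M N : Set V} (hM : IsIrred M) (h : vanishing M = vanishing N) :
    IsIrred N := by
  refine ⟨?_, fun hp hq hpq => ?_⟩
  · by_contra hN
    rw [Set.not_nonempty_iff_eq_empty] at hN
    subst hN
    obtain ⟨x, hx⟩ := hM.nonempty
    have : (fun _ => 1 : V → ℂ) ∈ vanishing M := by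
      rw [h]; exact ⟨const_mem_polyFun 1, by simp⟩
    exact one_ne_zero (this.2 x hx)
  · rw [← h] at hpq ⊢; exact hM.eq_zero_or hp hq hpq

theorem IsIrred.image {M : Set W} (hM : IsIrred M) (l : W →ₗ[ℂ] V) : IsIrred (l '' M) := by
  refine ⟨hM.nonempty.image l, fun {p q} hp hq hpq => ?_⟩
  have := hM.eq_zero_or (comp_linear_mem_polyFun hp l) (comp_linear_mem_polyFun hq l)
    ⟨comp_linear_mem_polyFun hpq.1 l, fun x hx => hpq.2 _ ⟨x, hx, rfl⟩⟩
  refine this.imp (fun h => ⟨hp, ?_⟩) (fun h => ⟨hq, ?_⟩)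
  all_goals
    rintro _ ⟨x, hx, rfl⟩
    exact h.2 x hx

end PolyFun

/-! ### Coordinate rings -/

section CoordRing

variable {V W : Type*} [AddCommGroup V] [Module ℂ V] [AddCommGroup W] [Module ℂ W]

/-- Restriction of functions to a subset. -/
def restrictHom (M : Set V) : (V → ℂ) →ₐ[ℂ] (M → ℂ) :=
  AlgHom.pi fun y : M => Pi.evalAlgHom ℂ (fun _ : V => ℂ) (y : V)

theorem coordRing_eq_map (M : Set V) : coordRing M = (polyFun V).map (restrictHom M) := by
  rw [polyFun, AlgHom.map_adjoin, ← Set.range_comp]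
  rfl

/-- Restriction of polynomial functions to `M`. -/
def toCoordRing (M : Set V) : polyFun V →ₐ[ℂ] coordRing M :=
  ((restrictHom M).comp (polyFun V).val).codRestrict _ fun p => by
    rw [coordRing_eq_map]; exact ⟨p, p.2, rfl⟩

@[simp]
theorem toCoordRing_apply (M : Set V) (p : polyFun V) (x : M) :
    (toCoordRing M p : M → ℂ) x = (p : V → ℂ) x := rfl

theorem toCoordRing_surjective (M : Set V) : Function.Surjective (toCoordRing M) := by
  rintro ⟨r, hr⟩
  have hr' := hr
  rw [coordRing_eq_map] at hr'
  obtain ⟨p, hp, rfl⟩ := hr'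
  exact ⟨⟨p, hp⟩, rfl⟩

theorem toCoordRing_eq_zero_iff (M : Set V) (p : polyFun V) :
    toCoordRing M p = 0 ↔ (p : V → ℂ) ∈ vanishing M := by
  constructor
  · intro h
    refine ⟨p.2, fun x hx => ?_⟩
    rw [← toCoordRing_apply M p ⟨x, hx⟩, h]; rfl
  · intro h
    ext x
    exact h.2 x x.2

instance [FiniteDimensional ℂ V] : Algebra.FiniteType ℂ (polyFun V) := by
  classical
  rw [← Subalgebra.fg_iff_finiteType]
  let b := Module.finBasis ℂ V
  refine ⟨Finset.univ.image fun i => (b.coord i : V → ℂ), le_antisymm ?_ ?_⟩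
  · refine Algebra.adjoin_mono ?_
    simp only [Finset.coe_image, Finset.coe_univ, Set.image_univ]
    rintro _ ⟨i, rfl⟩
    exact ⟨_, rfl⟩
  · refine Algebra.adjoin_le ?_
    rintro _ ⟨f, rfl⟩
    have : (f : V → ℂ) = ∑ i, f (b i) • (b.coord i : V → ℂ) := by
      ext v
      conv_lhs => rw [← b.sum_repr v]
      simp only [map_sum, map_smul, Finset.sum_apply, Pi.smul_apply, Module.Basis.coord_apply,
        smul_eq_mul, mul_comm]
    rw [SetLike.mem_coe]
    change (f : V → ℂ) ∈ _
    rw [this]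
    refine Subalgebra.sum_mem _ fun i _ => Subalgebra.smul_mem _ (Algebra.subset_adjoin ?_) _
    simp

instance [FiniteDimensional ℂ V] (M : Set V) : Algebra.FiniteType ℂ (coordRing M) :=
  Algebra.FiniteType.of_surjective (toCoordRing M) (toCoordRing_surjective M)

theorem IsIrred.isDomain {M : Set V} (hM : IsIrred M) : IsDomain (coordRing M) := by
  have : Nontrivial (coordRing M) := by
    obtain ⟨x, hx⟩ := hM.nonempty
    exact (evalAt M ⟨x, hx⟩ : coordRing M →+* ℂ).domain_nontrivial
  have : NoZeroDivisors (coordRing M) := by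
    refine ⟨fun {a b} hab => ?_⟩
    obtain ⟨p, rfl⟩ := toCoordRing_surjective M a
    obtain ⟨q, rfl⟩ := toCoordRing_surjective M b
    rw [← map_mul, toCoordRing_eq_zero_iff] at hab
    rw [toCoordRing_eq_zero_iff, toCoordRing_eq_zero_iff]
    exact hM.eq_zero_or p.2 q.2 hab
  exact NoZeroDivisors.to_isDomain _

/-- Pullback of functions along a linear map. -/
def coordMap {M : Set W} {N : Set V} (l : W →ₗ[ℂ] V) (h : Set.MapsTo l M N) :
    coordRing N →ₐ[ℂ] coordRing M :=
  ((AlgHom.pi fun y : M => Pi.evalAlgHom ℂ (fun _ : N => ℂ) ⟨l y, h y.2⟩).comp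
    (coordRing N).val).codRestrict _ fun r => by
      obtain ⟨p, rfl⟩ := toCoordRing_surjective N r
      exact (toCoordRing M ⟨_, comp_linear_mem_polyFun p.2 l⟩).2

theorem coordMap_toCoordRing {M : Set W} {N : Set V} (l : W →ₗ[ℂ] V) (h : Set.MapsTo l M N)
    (p : polyFun V) : coordMap l h (toCoordRing N p) =
      toCoordRing M ⟨fun w => (p : V → ℂ) (l w), comp_linear_mem_polyFun p.2 l⟩ := rfl

/-- The first order expansion at `m` in the direction `w`. -/
noncomputable def tangentHom (m w : V) : polyFun V →ₐ[ℂ] DualNumber ℂ :=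
  AlgHom.ofLinearMap
    { toFun := fun p => TrivSqZeroExt.inl ((p : V → ℂ) m) +
        TrivSqZeroExt.inr (lineDeriv ℂ (p : V → ℂ) m w)
      map_add' := fun p q => by
        ext
        · simp
        · simp [lineDeriv_polyFun_add p.2 q.2]
      map_smul' := fun c p => by
        have h := lineDeriv_polyFun_mul (const_mem_polyFun c) p.2 m w
        have h0 : lineDeriv ℂ (fun _ : V => c) m w = 0 := (hasDerivAt_const (0 : ℂ) c).deriv
        have h1 : (fun _ : V => c) * (p : V → ℂ) = ((c • p : polyFun V) : V → ℂ) := rfl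
        rw [h0, h1] at h
        ext
        · simp
        · simpa using h }
    (by
      have h0 : lineDeriv ℂ (1 : V → ℂ) m w = 0 := (hasDerivAt_const (0 : ℂ) (1 : ℂ)).deriv
      ext
      · simp
      · simp [h0])
    (by
      intro p q
      ext
      · simp
      · simp only [LinearMap.coe_mk, AddHom.coe_mk, MulMemClass.coe_mul,
          lineDeriv_polyFun_mul p.2 q.2]
        simp)

@[simp]
theorem fst_tangentHom (m w : V) (p : polyFun V) :
    (tangentHom m w p).fst = (p : V → ℂ) m := by simp [tangentHom]

@[simp]
theorem snd_tangentHom (m w : V) (p : polyFun V) :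
    (tangentHom m w p).snd = lineDeriv ℂ (p : V → ℂ) m w := by simp [tangentHom]

/-- On linear forms the infinitesimal part of `φ` is an element of the double dual, hence evaluation
at a vector. This turns algebraic lifts to dual numbers back into tangent vectors. -/
theorem exists_eq_tangentHom [FiniteDimensional ℂ V] {m : V} (φ : polyFun V →ₐ[ℂ] DualNumber ℂ)
    (h : ∀ p, (φ p).fst = (p : V → ℂ) m) : ∃ w, φ = tangentHom m w := by
  let L : Module.Dual ℂ (Module.Dual ℂ V) :=
    { toFun := fun f => (φ ⟨f, dual_mem_polyFun f⟩).snd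
      map_add' := fun f g => by
        rw [← TrivSqZeroExt.snd_add, ← map_add]; rfl
      map_smul' := fun c f => by
        rw [RingHom.id_apply, ← TrivSqZeroExt.snd_smul, ← map_smul]; rfl }
  refine ⟨(Module.evalEquiv ℂ V).symm L, ?_⟩
  have hL (f : Module.Dual ℂ V) : f ((Module.evalEquiv ℂ V).symm L) = L f := by
    simp
  refine AlgHom.adjoin_ext ?_
  rintro _ ⟨f, rfl⟩
  change φ ⟨f, dual_mem_polyFun f⟩ = tangentHom m _ ⟨f, dual_mem_polyFun f⟩
  ext
  · rw [h, fst_tangentHom]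
  · rw [snd_tangentHom]
    change L f = lineDeriv ℂ f m _
    rw [lineDeriv_dual, hL]

theorem isNilpotent_ker_fstHom : IsNilpotent (RingHom.ker (TrivSqZeroExt.fstHom ℂ ℂ ℂ : DualNumber ℂ →+* ℂ)) := by
  refine ⟨2, ?_⟩
  refine (pow_two (RingHom.ker (TrivSqZeroExt.fstHom ℂ ℂ ℂ : DualNumber ℂ →+* ℂ))).trans ?_
  rw [Ideal.zero_eq_bot, eq_bot_iff, Ideal.mul_le]
  intro a ha b hb
  have ha' : a.fst = 0 := ha
  have hb' : b.fst = 0 := hb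
  rw [Ideal.mem_bot]
  ext <;> simp [ha', hb']

/-- Generic smoothness: a linear map is generically submersive from an irreducible set onto its
image. -/
theorem exists_forall_tangentSpace_image_subset [FiniteDimensional ℂ V] [FiniteDimensional ℂ W]
    {M : Set W} (hM : IsIrred M) (l : W →ₗ[ℂ] V) :
    ∃ f ∈ polyFun W, f ∉ vanishing M ∧ ∀ m ∈ M, f m ≠ 0 →
      tangentSpace (l '' M) (l m) ⊆ l '' tangentSpace M m := by
  have := hM.isDomain
  have := (hM.image l).isDomain
  have hmaps := Set.mapsTo_image l M
  let B := coordRing (l '' M)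
  let A := coordRing M
  let : Algebra B A := (coordMap l hmaps : B →+* A).toAlgebra
  have halg (b : B) : algebraMap B A b = coordMap l hmaps b := rfl
  have : IsScalarTower ℂ B A := IsScalarTower.of_algebraMap_eq fun c =>
    ((coordMap l hmaps).commutes c).symm
  have hinj : Function.Injective (algebraMap B A) := by
    rw [injective_iff_map_eq_zero]
    intro b hb
    obtain ⟨p, rfl⟩ := toCoordRing_surjective _ b
    rw [halg, coordMap_toCoordRing, toCoordRing_eq_zero_iff] at hb
    rw [toCoordRing_eq_zero_iff]
    refine ⟨p.2, ?_⟩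
    rintro _ ⟨x, hx, rfl⟩
    exact hb.2 x hx
  have : CharZero B := charZero_of_injective_algebraMap (algebraMap ℂ B).injective
  have : IsNoetherianRing B := Algebra.FiniteType.isNoetherianRing ℂ B
  have : Algebra.FiniteType B A := Algebra.FiniteType.of_restrictScalars_finiteType ℂ B A
  obtain ⟨f, hf, hs⟩ := exists_ne_zero_smooth_away B A hinj
  obtain ⟨f, rfl⟩ := toCoordRing_surjective _ f
  refine ⟨f, f.2, fun h => hf ((toCoordRing_eq_zero_iff _ _).mpr h), fun m hm hfm w hw => ?_⟩
  let π : DualNumber ℂ →+* ℂ := (TrivSqZeroExt.fstHom ℂ ℂ ℂ : DualNumber ℂ →+* ℂ)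
  -- The vector `w` becomes a dual-number point of the image. Smoothness lifts it to one of `M` over
  -- `m`, which is a tangent vector mapping to `w`.
  let ψ : B →+* DualNumber ℂ := RingHom.liftOfSurjective
    (toCoordRing (l '' M) : polyFun V →+* B) (toCoordRing_surjective _)
    ⟨(tangentHom (l m) w : polyFun V →+* DualNumber ℂ), fun p hp => by
      have hp' := (toCoordRing_eq_zero_iff _ p).mp hp
      rw [RingHom.mem_ker]
      ext
      · simpa using hp'.2 _ ⟨m, hm, rfl⟩
      · simpa using hw _ hp'.1 hp'.2⟩
  have hψ (p : polyFun V) : ψ (toCoordRing _ p) = tangentHom (l m) w p :=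
    RingHom.liftOfRightInverse_comp_apply _ _ _ _ p
  obtain ⟨φ, h1, h2⟩ := exists_lift_of_smooth_away hs π (fun c => ⟨TrivSqZeroExt.inl c, rfl⟩)
    isNilpotent_ker_fstHom ψ (evalAt M ⟨m, hm⟩ : A →+* ℂ) (by
      ext b
      obtain ⟨p, rfl⟩ := toCoordRing_surjective _ b
      simp only [RingHom.comp_apply, hψ, halg]
      exact (fst_tangentHom _ _ _).symm) (isUnit_iff_ne_zero.mpr hfm)
  let φ' : A →ₐ[ℂ] DualNumber ℂ := { φ with
    commutes' := fun c => by
      have e1 : algebraMap ℂ A c = algebraMap B A (toCoordRing _ (algebraMap ℂ (polyFun V) c)) := by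
        rw [AlgHom.commutes, ← IsScalarTower.algebraMap_apply]
      have e2 := congr($h2 (toCoordRing _ (algebraMap ℂ (polyFun V) c)))
      rw [hψ] at e2
      change φ (algebraMap ℂ A c) = _
      rw [e1]
      exact e2.trans ((tangentHom (l m) w).commutes c) }
  obtain ⟨z, hz⟩ := exists_eq_tangentHom (m := m) (φ'.comp (toCoordRing M)) fun p =>
    congr($h1 (toCoordRing M p))
  refine ⟨z, fun p hp hpM => ?_, ?_⟩
  · have e := congr(TrivSqZeroExt.snd ($hz ⟨p, hp⟩))
    rw [snd_tangentHom, AlgHom.comp_apply, (toCoordRing_eq_zero_iff _ _).mpr ⟨hp, hpM⟩] at e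
    simpa using e.symm
  · rw [← sub_eq_zero, ← Module.forall_dual_apply_eq_zero_iff ℂ]
    intro g
    have e := congr(TrivSqZeroExt.snd ($hz ⟨_, comp_linear_mem_polyFun (dual_mem_polyFun g) l⟩))
    have e2 := congr(TrivSqZeroExt.snd ($h2 (toCoordRing _ ⟨_, dual_mem_polyFun g⟩)))
    rw [hψ, snd_tangentHom, lineDeriv_dual] at e2
    rw [snd_tangentHom, lineDeriv_comp_linear, lineDeriv_dual] at e
    rw [map_sub, sub_eq_zero, ← e, ← e2]
    rfl

/-- A generic point of an irreducible set is smooth. -/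
theorem exists_forall_isSmoothPoint [FiniteDimensional ℂ V] {M : Set V} (hM : IsIrred M) :
    ∃ f ∈ polyFun V, f ∉ vanishing M ∧ ∀ m ∈ M, f m ≠ 0 → IsSmoothPoint M m := by
  have := hM.isDomain
  obtain ⟨f, hf, hs⟩ := exists_ne_zero_smooth_away ℂ (coordRing M)
    (algebraMap ℂ _).injective
  obtain ⟨f, rfl⟩ := toCoordRing_surjective _ f
  refine ⟨f, f.2, fun h => hf ((toCoordRing_eq_zero_iff _ _).mpr h), fun m hm hfm => ⟨hm, ?_⟩⟩
  have : Algebra.FinitePresentation ℂ (coordRing M) :=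
    Algebra.FinitePresentation.of_finiteType.mp inferInstance
  have h := Algebra.basicOpen_subset_smoothLocus_iff_smooth.mpr hs
  exact @h ⟨RingHom.ker (evalAt M ⟨m, hm⟩), inferInstance⟩ hfm

/-- An irreducible set with the same tangent space as a subset at a smooth point of the subset
has the same closure. -/
theorem vanishing_subset_of_tangentSpace_subset [FiniteDimensional ℂ V] {Z Z' : Set V}
    (hZ' : IsIrred Z') (h : vanishing Z' ⊆ vanishing Z) {z : V} (hz : IsSmoothPoint Z z)
    (ht : tangentSpace Z' z ⊆ tangentSpace Z z) : vanishing Z ⊆ vanishing Z' := by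
  -- The hypothesis only puts `Z` in the closure of `Z'`; adjoining `Z` to `Z'` changes neither the
  -- vanishing functions nor the tangent spaces.
  wlog hsub : Z ⊆ Z' generalizing Z'
  · have e : vanishing (Z' ∪ Z) = vanishing Z' := by
      refine (vanishing_anti Set.subset_union_left).antisymm fun p hp => ⟨hp.1, ?_⟩
      rintro x (hx | hx)
      exacts [hp.2 x hx, (h hp).2 x hx]
    rw [← e]
    exact this (hZ'.congr e.symm) (by rwa [e]) (by rwa [tangentSpace_congr e])
      Set.subset_union_right
  obtain ⟨hzZ, hs⟩ := hz
  intro p hp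
  have := hZ'.isDomain
  have : IsNoetherianRing (coordRing Z') := Algebra.FiniteType.isNoetherianRing ℂ _
  have hmap : Set.MapsTo (LinearMap.id : V →ₗ[ℂ] V) Z Z' := hsub
  have hπ (q : polyFun V) : coordMap LinearMap.id hmap (toCoordRing Z' q) = toCoordRing Z q := rfl
  refine (toCoordRing_eq_zero_iff Z' ⟨p, hp.1⟩).mp ?_
  refine eq_zero_of_isSmoothAt (coordMap LinearMap.id hmap) ?_ (evalAt Z ⟨z, hzZ⟩) hs ?_ ?_
  · intro r
    obtain ⟨q, rfl⟩ := toCoordRing_surjective _ r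
    exact ⟨_, hπ q⟩
  · intro φ hφ r hr
    obtain ⟨q, rfl⟩ := toCoordRing_surjective _ r
    obtain ⟨w, hw⟩ := exists_eq_tangentHom (m := z) (φ.comp (toCoordRing Z')) fun p =>
      hφ (toCoordRing Z' p)
    have hwt : w ∈ tangentSpace Z' z := fun p hp hpM => by
      have e := congr(TrivSqZeroExt.snd ($hw ⟨p, hp⟩))
      rw [snd_tangentHom, AlgHom.comp_apply, (toCoordRing_eq_zero_iff _ _).mpr ⟨hp, hpM⟩] at e
      simpa using e.symm
    rw [hπ, toCoordRing_eq_zero_iff] at hr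
    have e := congr($hw q)
    rw [AlgHom.comp_apply] at e
    rw [e]
    ext
    · simpa using hr.2 z hzZ
    · simpa using ht hwt _ hr.1 hr.2
  · rw [hπ, toCoordRing_eq_zero_iff]
    exact hp

end CoordRing

/-! ### Conormal bundles of orbits -/

section Conormal

variable {V U : Type*} [AddCommGroup V] [Module ℂ V] [AddCommGroup U] [Module ℂ U]

/-- Irreducibility of the line serves to join two conormal vectors in one fibre, and to put the
origin in the closure of a cone. -/
theorem isIrred_univ_complex : IsIrred (Set.univ : Set ℂ) := by
  have key {p : ℂ → ℂ} (hp : p ∈ polyFun ℂ) : ∃ P : Polynomial ℂ, ∀ t, p t = P.eval t := by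
    induction hp using Algebra.adjoin_induction with
    | mem x hx =>
      obtain ⟨f, rfl⟩ := hx
      refine ⟨Polynomial.C (f 1) * Polynomial.X, fun t => ?_⟩
      have := map_smul f t 1
      rw [smul_eq_mul, mul_one, smul_eq_mul] at this
      rw [Polynomial.eval_mul, Polynomial.eval_C, Polynomial.eval_X, mul_comm]
      exact this
    | algebraMap r => exact ⟨Polynomial.C r, fun t => by simp⟩
    | add x y _ _ hx hy =>
      obtain ⟨P, hP⟩ := hx
      obtain ⟨Q, hQ⟩ := hy
      exact ⟨P + Q, fun t => by simp [hP, hQ]⟩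
    | mul x y _ _ hx hy =>
      obtain ⟨P, hP⟩ := hx
      obtain ⟨Q, hQ⟩ := hy
      exact ⟨P * Q, fun t => by simp [hP, hQ]⟩
  refine ⟨⟨0, trivial⟩, fun {p q} hp hq hpq => ?_⟩
  obtain ⟨P, hP⟩ := key hp
  obtain ⟨Q, hQ⟩ := key hq
  have : P * Q = 0 := Polynomial.funext fun t => by
    have := hpq.2 t trivial
    simpa [hP, hQ] using this
  rcases mul_eq_zero.mp this with h | h
  · exact .inl ⟨hp, fun t _ => by simp [hP, h]⟩
  · exact .inr ⟨hq, fun t _ => by simp [hQ, h]⟩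

/-- This gives the covering argument: if an irreducible set is covered by finitely many pieces, one
of them is dense in it. -/
theorem IsIrred.prod_notMem {M : Set V} (hM : IsIrred M) {I : Type*} (s : Finset I)
    (p : I → V → ℂ) (h : ∀ i ∈ s, p i ∈ polyFun V ∧ p i ∉ vanishing M) :
    ∏ i ∈ s, p i ∈ polyFun V ∧ ∏ i ∈ s, p i ∉ vanishing M := by
  classical
  induction s using Finset.induction_on with
  | empty =>
    refine ⟨const_mem_polyFun 1, fun h => ?_⟩
    obtain ⟨x, hx⟩ := hM.nonempty
    simpa using h.2 x hx
  | insert a s ha ih =>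
    have h1 := h a (Finset.mem_insert_self a s)
    have h2 := ih fun i hi => h i (Finset.mem_insert_of_mem hi)
    rw [Finset.prod_insert ha]
    refine ⟨(polyFun V).mul_mem h1.1 h2.1, fun h => ?_⟩
    exact (hM.eq_zero_or h1.1 h2.1 h).elim h1.2 h2.2

/-- The annihilator in `U` of a subset of `V` with respect to a pairing. -/
def annihilator (B : V →ₗ[ℂ] U →ₗ[ℂ] ℂ) (T : Set V) : Submodule ℂ U where
  carrier := {ξ | ∀ w ∈ T, B w ξ = 0}
  add_mem' {a b} ha hb w hw := by rw [map_add, ha w hw, hb w hw, add_zero]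
  zero_mem' w _ := map_zero _
  smul_mem' c a ha w hw := by rw [map_smul, ha w hw, smul_zero]

/-- The perfect pairing identifies `U` with the dual of `V` and the annihilator with the usual dual
annihilator. -/
theorem finrank_add_finrank_annihilator [FiniteDimensional ℂ V] (B : V →ₗ[ℂ] U →ₗ[ℂ] ℂ)
    [B.IsPerfPair] (T : Submodule ℂ V) :
    Module.finrank ℂ T + Module.finrank ℂ (annihilator B (T : Set V)) = Module.finrank ℂ V := by
  suffices h : (annihilator B (T : Set V)).map (B.flip.toPerfPair : U →ₗ[ℂ] Module.Dual ℂ V) =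
      T.dualAnnihilator by
    rw [← Subspace.finrank_add_finrank_dualAnnihilator_eq T, ← h, LinearEquiv.finrank_map_eq]
  ext φ
  simp only [Submodule.mem_map, Submodule.mem_dualAnnihilator]
  constructor
  · rintro ⟨ξ, hξ, rfl⟩ w hw
    exact hξ w hw
  · intro h
    obtain ⟨ξ, rfl⟩ := B.flip.toPerfPair.surjective φ
    exact ⟨ξ, fun w hw => h w hw, rfl⟩

/-- The conormal bundle of `O ⊆ V`. -/
def conormal (B : V →ₗ[ℂ] U →ₗ[ℂ] ℂ) (O : Set V) : Set (V × U) :=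
  {z | z.1 ∈ O ∧ z.2 ∈ annihilator B (tangentSpace O z.1)}

variable {Γ R : Type*} [Group Γ] [Ring R] [Algebra ℂ R]

/-- The orbit of `x` under the action obtained from a homomorphism `τ` to the units of an algebra
`R` and a representation `e` of `R`. -/
def orbitThrough (τ : Γ →* R) (e : R →ₐ[ℂ] Module.End ℂ V) (x : V) : Set V :=
  Set.range fun g => e (τ g) x

/-- The orbit map, extended to a linear map on the ambient algebra. -/
def orbitMap (e : R →ₐ[ℂ] Module.End ℂ V) (x : V) : R →ₗ[ℂ] V :=
  (LinearMap.applyₗ x : Module.End ℂ V →ₗ[ℂ] V) ∘ₗ e.toLinearMap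

@[simp]
theorem orbitMap_apply (e : R →ₐ[ℂ] Module.End ℂ V) (x : V) (X : R) : orbitMap e x X = e X x := rfl

theorem image_orbitMap (τ : Γ →* R) (e : R →ₐ[ℂ] Module.End ℂ V) (x : V) :
    orbitMap e x '' Set.range τ = orbitThrough τ e x := by
  rw [← Set.range_comp]; rfl

section Orbit

variable (τ : Γ →* R) (e : R →ₐ[ℂ] Module.End ℂ V)

theorem act_act (g h : Γ) (x : V) : e (τ g) (e (τ h) x) = e (τ (g * h)) x := by
  rw [map_mul, map_mul]; rfl

theorem act_inv_act (g : Γ) (x : V) : e (τ g⁻¹) (e (τ g) x) = x := by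
  rw [act_act, inv_mul_cancel, map_one, map_one]; rfl

theorem act_act_inv (g : Γ) (x : V) : e (τ g) (e (τ g⁻¹) x) = x := by
  rw [act_act, mul_inv_cancel, map_one, map_one]; rfl

theorem mem_orbitThrough_self (x : V) : x ∈ orbitThrough τ e x := ⟨1, by simp⟩

theorem act_mem_orbitThrough (g : Γ) {x y : V} (h : y ∈ orbitThrough τ e x) :
    e (τ g) y ∈ orbitThrough τ e x := by
  obtain ⟨h, rfl⟩ := h
  exact ⟨g * h, (act_act τ e g h x).symm⟩

theorem orbitThrough_eq {x y : V} (h : y ∈ orbitThrough τ e x) :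
    orbitThrough τ e y = orbitThrough τ e x := by
  obtain ⟨h, rfl⟩ := h
  refine Set.Subset.antisymm ?_ ?_
  · rintro _ ⟨g, rfl⟩
    exact ⟨g * h, (act_act τ e g h x).symm⟩
  · rintro _ ⟨g, rfl⟩
    refine ⟨g * h⁻¹, ?_⟩
    simp only [act_act]
    rw [inv_mul_cancel_right]

theorem act_mem_tangentSpace (g : Γ) {x y w : V}
    (hw : w ∈ tangentSpace (orbitThrough τ e x) y) :
    e (τ g) w ∈ tangentSpace (orbitThrough τ e x) (e (τ g) y) :=
  map_mem_tangentSpace (e (τ g)) (fun _ h => act_mem_orbitThrough τ e g h) hw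

theorem orbitMap_mem_tangentSpace {X : R} (hX : X ∈ tangentSpace (Set.range τ) 1) (x : V) :
    e X x ∈ tangentSpace (orbitThrough τ e x) x := by
  have := map_mem_tangentSpace (N := orbitThrough τ e x) (orbitMap e x)
    (by rintro _ ⟨g, rfl⟩; exact ⟨g, rfl⟩) hX
  simpa using this

/-- The tangent space of an orbit consists of the velocity vectors of the action. -/
theorem exists_eq_of_mem_tangentSpace [FiniteDimensional ℂ R] [FiniteDimensional ℂ V]
    (hτ : IsIrred (Set.range τ)) {x w : V}
    (hw : w ∈ tangentSpace (orbitThrough τ e x) x) :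
    ∃ X ∈ tangentSpace (Set.range τ) 1, e X x = w := by
  -- Generic smoothness makes the orbit map submersive at some `g`; translating by `g⁻¹` moves this
  -- to the identity.
  obtain ⟨f, hf, hf', h⟩ := exists_forall_tangentSpace_image_subset hτ (orbitMap e x)
  obtain ⟨g, hg⟩ : ∃ g, f (τ g) ≠ 0 := by
    by_contra! H
    exact hf' ⟨hf, by rintro _ ⟨g, rfl⟩; exact H g⟩
  rw [image_orbitMap] at h
  obtain ⟨Z, hZ, hZw⟩ := h _ ⟨g, rfl⟩ hg (act_mem_tangentSpace τ e g hw)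
  refine ⟨τ g⁻¹ * Z, ?_, ?_⟩
  · have := map_mem_tangentSpace (N := Set.range τ) (LinearMap.mulLeft ℂ (τ g⁻¹))
      (by rintro _ ⟨k, rfl⟩; exact ⟨g⁻¹ * k, by simp⟩) hZ
    simpa [← map_mul] using this
  · have : e (τ g⁻¹ * Z) x = e (τ g⁻¹) (e Z x) := by rw [map_mul]; rfl
    rw [this]
    rw [orbitMap_apply] at hZw
    rw [hZw, act_inv_act]

end Orbit

variable (τ : Γ →* R) (e : R →ₐ[ℂ] Module.End ℂ V) (e' : R →ₐ[ℂ] Module.End ℂ U)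
  (B : V →ₗ[ℂ] U →ₗ[ℂ] ℂ)

/-- The function `X ↦ B (X x) (X ξ)` is constant on the group, so its derivative at `1` vanishes in
tangent directions. -/
theorem pairing_add_eq_zero [FiniteDimensional ℂ V]
    (hB : ∀ g x ξ, B (e (τ g) x) (e' (τ g) ξ) = B x ξ) {X : R}
    (hX : X ∈ tangentSpace (Set.range τ) 1) (x : V) (ξ : U) : B (e X x) ξ + B x (e' X ξ) = 0 := by
  have hmem := bilin_mem_polyFun B (orbitMap e x) (orbitMap e' ξ)
  have h := hX _ ((polyFun R).sub_mem hmem (const_mem_polyFun (B x ξ))) (by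
    rintro _ ⟨g, rfl⟩
    simp [hB])
  have hd : HasLineDerivAt ℂ (((fun w => B (orbitMap e x w) (orbitMap e' ξ w)) - fun _ => B x ξ) : R → ℂ)
      (B (e X x) ξ + B x (e' X ξ)) 1 X := by
    have e1 : (fun t : ℂ => (((fun w => B (orbitMap e x w) (orbitMap e' ξ w)) - fun _ => B x ξ) : R → ℂ)
        (1 + t • X)) = fun t => t * (B (e X x) ξ + B x (e' X ξ)) + t * (t * B (e X x) (e' X ξ)) := by
      ext t
      simp
      ring
    unfold HasLineDerivAt
    rw [e1]
    have h1 : HasDerivAt (fun t : ℂ => t * (B (e X x) ξ + B x (e' X ξ)))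
      (1 * (B (e X x) ξ + B x (e' X ξ))) 0 := (hasDerivAt_id (0 : ℂ)).mul_const _
    have h2 : HasDerivAt (fun t : ℂ => t * B (e X x) (e' X ξ)) (1 * B (e X x) (e' X ξ)) 0 :=
      (hasDerivAt_id (0 : ℂ)).mul_const _
    refine (h1.add ((hasDerivAt_id (0 : ℂ)).mul h2)).congr_deriv ?_
    simp
  rw [hd.lineDeriv] at h
  exact h

theorem act_mem_conormal
    (hB : ∀ g x ξ, B (e (τ g) x) (e' (τ g) ξ) = B x ξ) (g : Γ) {x : V} {z : V × U}
    (hz : z ∈ conormal B (orbitThrough τ e x)) :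
    (e (τ g) z.1, e' (τ g) z.2) ∈ conormal B (orbitThrough τ e x) := by
  refine ⟨act_mem_orbitThrough τ e g hz.1, fun w hw => ?_⟩
  have h1 := act_mem_tangentSpace τ e g⁻¹ hw
  rw [act_inv_act] at h1
  have := hB g (e (τ g⁻¹) w) z.2
  rw [act_act_inv] at this
  rw [this]
  exact hz.2 _ h1

/-- The conormal bundle of an orbit in the dual space, with factors exchanged. -/
def dualConormal (B : V →ₗ[ℂ] U →ₗ[ℂ] ℂ) (O : Set U) : Set (V × U) :=
  LinearEquiv.prodComm ℂ U V '' conormal B.flip O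

theorem mem_dualConormal {B : V →ₗ[ℂ] U →ₗ[ℂ] ℂ} {O : Set U} {z : V × U} :
    z ∈ dualConormal B O ↔ z.2 ∈ O ∧ z.1 ∈ annihilator B.flip (tangentSpace O z.2) := by
  constructor
  · rintro ⟨y, hy, rfl⟩; exact hy
  · intro h; exact ⟨z.swap, h, rfl⟩

/-- Suppose neither `p` nor `q` vanishes identically on the bundle. Translating to the fibre over
`x` gives conormal vectors `ζ` and `ζ'` there, and irreducibility of the group gives one `g` with `p
≠ 0` at `g (x, ζ)` and `q ≠ 0` at `g (x, ζ')`. The line through these two points stays in the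
bundle, because the fibre is linear, and on an irreducible line `p * q` cannot vanish identically.
-/
theorem isIrred_conormal (hτ : IsIrred (Set.range τ))
    (hB : ∀ g x ξ, B (e (τ g) x) (e' (τ g) ξ) = B x ξ) (x : V) :
    IsIrred (conormal B (orbitThrough τ e x)) := by
  have hx := mem_orbitThrough_self τ e x
  refine ⟨⟨(x, 0), hx, fun w _ => map_zero _⟩, fun {p q} hp hq hpq => ?_⟩
  by_contra! H
  obtain ⟨hp0, hq0⟩ := H
  have key {p : V × U → ℂ} (hp : p ∈ polyFun (V × U))
      (hp0 : p ∉ vanishing (conormal B (orbitThrough τ e x))) :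
      ∃ ζ ∈ annihilator B (tangentSpace (orbitThrough τ e x) x),
        (fun X => p ((orbitMap e x).prod (orbitMap e' ζ) X)) ∉ vanishing (Set.range τ) := by
    obtain ⟨⟨y, ζ⟩, hz, hpz⟩ : ∃ z ∈ conormal B (orbitThrough τ e x), p z ≠ 0 := by
      by_contra! H
      exact hp0 ⟨hp, H⟩
    obtain ⟨g, rfl⟩ := hz.1
    have h1 := act_mem_conormal τ e e' B hB g⁻¹ hz
    simp only [act_inv_act] at h1
    refine ⟨_, h1.2, fun h => hpz ?_⟩
    have := h.2 _ ⟨g, rfl⟩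
    simpa [act_act_inv] using this
  obtain ⟨ζ, hζ, hpζ⟩ := key hp hp0
  obtain ⟨ζ', hζ', hqζ⟩ := key hq hq0
  have h1 := comp_linear_mem_polyFun hp ((orbitMap e x).prod (orbitMap e' ζ))
  have h2 := comp_linear_mem_polyFun hq ((orbitMap e x).prod (orbitMap e' ζ'))
  obtain ⟨g, hg⟩ : ∃ g, p (e (τ g) x, e' (τ g) ζ) * q (e (τ g) x, e' (τ g) ζ') ≠ 0 := by
    by_contra! H
    refine (hτ.eq_zero_or h1 h2 ⟨(polyFun R).mul_mem h1 h2, ?_⟩).elim hpζ hqζ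
    rintro _ ⟨g, rfl⟩
    exact H g
  obtain ⟨hgp, hgq⟩ := mul_ne_zero_iff.mp hg
  let l : ℂ →ₗ[ℂ] V × U := LinearMap.toSpanSingleton ℂ _ ((0, e' (τ g) (ζ' - ζ)) : V × U)
  let c : V × U := (e (τ g) x, e' (τ g) ζ)
  have h3 := comp_affine_mem_polyFun hp l c
  have h4 := comp_affine_mem_polyFun hq l c
  have hl (t : ℂ) : l t + c = (e (τ g) x, e' (τ g) (t • (ζ' - ζ) + ζ)) := by
    simp [l, c, LinearMap.toSpanSingleton_apply]
  rcases isIrred_univ_complex.eq_zero_or h3 h4 ⟨(polyFun ℂ).mul_mem h3 h4, fun t _ => by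
    simp only [Pi.mul_apply, hl]
    refine hpq.2 _ (act_mem_conormal τ e e' B hB g
      (z := (x, t • (ζ' - ζ) + ζ)) ⟨hx, ?_⟩)
    exact add_mem (Submodule.smul_mem _ _ (sub_mem hζ' hζ)) hζ⟩ with h | h
  · have := h.2 0 trivial
    simp only [hl] at this
    simp [hgp] at this
  · have := h.2 1 trivial
    simp only [hl] at this
    simp [hgq] at this

theorem finrank_tangentSubmodule_image_equiv (E : V ≃ₗ[ℂ] U) (M : Set V) (m : V) :
    Module.finrank ℂ (tangentSubmodule (E '' M) (E m)) = Module.finrank ℂ (tangentSubmodule M m) := by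
  suffices h : tangentSubmodule (E '' M) (E m) =
      (tangentSubmodule M m).map (E : V →ₗ[ℂ] U) by rw [h, LinearEquiv.finrank_map_eq]
  ext w
  constructor
  · intro hw
    refine ⟨E.symm w, ?_, E.apply_symm_apply w⟩
    have := map_mem_tangentSpace (N := M) (E.symm : U →ₗ[ℂ] V)
      (by rintro _ ⟨x, hx, rfl⟩; simpa using hx) hw
    rw [LinearEquiv.coe_coe, E.symm_apply_apply] at this
    exact this
  · rintro ⟨w, hw, rfl⟩
    exact map_mem_tangentSpace (E : V →ₗ[ℂ] U) (Set.mapsTo_image E M) hw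

variable [FiniteDimensional ℂ R] [FiniteDimensional ℂ V] [FiniteDimensional ℂ U]

/-- The zero fibre of the moment map is described by orbits on either side. -/
theorem mem_annihilator_orbit_iff (hτ : IsIrred (Set.range τ))
    (hB : ∀ g x ξ, B (e (τ g) x) (e' (τ g) ξ) = B x ξ) (x : V) (ξ : U) :
    ξ ∈ annihilator B (tangentSpace (orbitThrough τ e x) x) ↔
      x ∈ annihilator B.flip (tangentSpace (orbitThrough τ e' ξ) ξ) := by
  constructor
  · intro h w hw
    obtain ⟨X, hX, rfl⟩ := exists_eq_of_mem_tangentSpace τ e' hτ hw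
    have := pairing_add_eq_zero τ e e' B hB hX x ξ
    rw [h _ (orbitMap_mem_tangentSpace τ e hX x), zero_add] at this
    exact this
  · intro h w hw
    obtain ⟨X, hX, rfl⟩ := exists_eq_of_mem_tangentSpace τ e hτ hw
    have := pairing_add_eq_zero τ e e' B hB hX x ξ
    have h2 : B x (e' X ξ) = 0 := h _ (orbitMap_mem_tangentSpace τ e' hX ξ)
    rw [h2, add_zero] at this
    exact this

/-- The first projection maps the tangent space onto that of the orbit, since the group moves the
point inside the bundle. The kernel is the annihilator: it contains the fibre directions, and it is
no larger because the equations `B (X u) η = 0`, for `X` tangent at `1`, hold on the bundle. The two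
dimensions add up to `dim V`. -/
theorem finrank_tangentSubmodule_conormal [B.IsPerfPair] (hτ : IsIrred (Set.range τ))
    (hB : ∀ g x ξ, B (e (τ g) x) (e' (τ g) ξ) = B x ξ) (x : V) {z : V × U}
    (hz : z ∈ conormal B (orbitThrough τ e x)) :
    Module.finrank ℂ (tangentSubmodule (conormal B (orbitThrough τ e x)) z) =
      Module.finrank ℂ V := by
  obtain ⟨y, ξ⟩ := z
  have hy : y ∈ orbitThrough τ e x := hz.1
  rw [← orbitThrough_eq τ e hy] at hz ⊢
  clear hy x
  set O := orbitThrough τ e y with hO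
  set S := tangentSubmodule (conormal B O) (y, ξ) with hS
  let T := tangentSubmodule O y
  have hT : (T : Set V) = tangentSpace O y := rfl
  let π : S →ₗ[ℂ] V := (LinearMap.fst ℂ V U).domRestrict S
  have hrange : LinearMap.range π = T := by
    ext w
    constructor
    · rintro ⟨s, rfl⟩
      exact map_mem_tangentSpace (LinearMap.fst ℂ V U) (fun z hz => hz.1) s.2
    · intro hw
      obtain ⟨X, hX, rfl⟩ := exists_eq_of_mem_tangentSpace τ e hτ hw
      have := map_mem_tangentSpace (N := conormal B O) ((orbitMap e y).prod (orbitMap e' ξ)) (by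
        rintro _ ⟨g, rfl⟩
        exact act_mem_conormal τ e e' B hB g hz) hX
      have h1 : (orbitMap e y).prod (orbitMap e' ξ) 1 = (y, ξ) := by simp
      rw [h1] at this
      exact ⟨⟨_, this⟩, rfl⟩
  have hker : (LinearMap.ker π).map S.subtype =
      (annihilator B (tangentSpace O y)).map (LinearMap.inr ℂ V U) := by
    ext ⟨w, ζ⟩
    simp only [Submodule.mem_map, LinearMap.mem_ker, Submodule.subtype_apply, LinearMap.inr_apply]
    constructor
    · rintro ⟨⟨⟨w', ζ'⟩, hs⟩, hw', heq⟩
      obtain ⟨rfl, rfl⟩ := Prod.mk.inj heq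
      obtain rfl : w' = 0 := hw'
      refine ⟨ζ', fun v hv => ?_, rfl⟩
      obtain ⟨X, hX, rfl⟩ := exists_eq_of_mem_tangentSpace τ e hτ hv
      have hd := hs _ (bilin_mem_polyFun B (e X ∘ₗ LinearMap.fst ℂ V U) (LinearMap.snd ℂ V U)) (by
        intro u hu
        refine hu.2 _ ?_
        rw [hO, ← orbitThrough_eq τ e hu.1]
        exact orbitMap_mem_tangentSpace τ e hX u.1)
      have hl : HasLineDerivAt ℂ (fun w : V × U => B ((e X ∘ₗ LinearMap.fst ℂ V U) w)
          ((LinearMap.snd ℂ V U) w)) (B (e X y) ζ') (y, ξ) (0, ζ') := by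
        have : HasDerivAt (fun t : ℂ => B (e X y) ξ + t * B (e X y) ζ') (1 * B (e X y) ζ') 0 :=
          ((hasDerivAt_id (0 : ℂ)).mul_const _).const_add _
        simpa [HasLineDerivAt] using this
      rw [hl.lineDeriv] at hd
      exact hd
    · rintro ⟨ζ', hζ', heq⟩
      obtain ⟨rfl, rfl⟩ := Prod.mk.inj heq
      refine ⟨⟨(0, ζ'), fun p hp hpN => ?_⟩, rfl, rfl⟩
      have : (fun t : ℂ => p ((y, ξ) + t • ((0, ζ') : V × U))) = fun _ => 0 := by
        ext t
        refine hpN _ ⟨?_, ?_⟩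
        · simpa using hz.1
        · simpa using add_mem hz.2 (Submodule.smul_mem _ t hζ')
      rw [lineDeriv, this]
      exact deriv_const 0 0
  rw [← LinearMap.finrank_range_add_finrank_ker π, hrange,
    (Submodule.equivMapOfInjective S.subtype S.injective_subtype (LinearMap.ker π)).finrank_eq, hker,
    ← (Submodule.equivMapOfInjective (LinearMap.inr ℂ V U) LinearMap.inr_injective _).finrank_eq,
    ← hT, finrank_add_finrank_annihilator]

/-- The closure of the conormal bundle of an orbit in the dual space is the closure of the conormal
bundle of an orbit. -/
theorem exists_vanishing_conormal_eq [B.IsPerfPair] (hτ : IsIrred (Set.range τ))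
    (hB : ∀ g x ξ, B (e (τ g) x) (e' (τ g) ξ) = B x ξ)
    (hfin : (Set.range (orbitThrough τ e)).Finite) (ξ : U) :
    ∃ x : V, vanishing (conormal B (orbitThrough τ e x)) =
      vanishing (dualConormal B (orbitThrough τ e' ξ)) := by
  classical
  have hB' : ∀ g ξ x, B.flip (e' (τ g) ξ) (e (τ g) x) = B.flip ξ x := fun g ξ x => hB g x ξ
  set N' := dualConormal B (orbitThrough τ e' ξ) with hN'
  have hirr : IsIrred N' := (isIrred_conormal τ e' e B.flip hτ hB' ξ).image
    (LinearEquiv.prodComm ℂ U V : U × V →ₗ[ℂ] V × U)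
  obtain ⟨f, hf, hf0, hfs⟩ := exists_forall_isSmoothPoint hirr
  -- Some orbit `O` has the property that the points of `N'` over `O` with `f ≠ 0` are dense in
  -- `N'`. Otherwise the product of `f` with one witness for each of the finitely many orbits would
  -- vanish on `N'`.
  obtain ⟨O, ⟨x, rfl⟩, hO⟩ : ∃ O ∈ Set.range (orbitThrough τ e), ∀ p ∈ polyFun (V × U),
      (∀ z ∈ N', f z ≠ 0 → z.1 ∈ O → p z = 0) → p ∈ vanishing N' := by
    by_contra! H
    choose! p hp h1 h2 using H
    have := hirr.prod_notMem hfin.toFinset p fun O hO => by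
      rw [Set.Finite.mem_toFinset] at hO
      exact ⟨hp O hO, h2 O hO⟩
    have hmul : f * ∏ O ∈ hfin.toFinset, p O ∈ vanishing N' := by
      refine ⟨(polyFun _).mul_mem hf this.1, fun z hz => ?_⟩
      rw [Pi.mul_apply, Finset.prod_apply, mul_eq_zero, or_iff_not_imp_left]
      intro hfz
      refine Finset.prod_eq_zero (i := orbitThrough τ e z.1) (by simp) ?_
      exact h1 _ ⟨_, rfl⟩ z hz hfz (mem_orbitThrough_self τ e z.1)
    exact (hirr.eq_zero_or hf this.1 hmul).elim hf0 this.2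
  have hsub {z : V × U} (hz : z ∈ N') (hzx : z.1 ∈ orbitThrough τ e x) :
      z ∈ conormal B (orbitThrough τ e x) := by
    have hz := mem_dualConormal.mp hz
    rw [← orbitThrough_eq τ e' hz.1] at hz
    refine ⟨hzx, ?_⟩
    rw [← orbitThrough_eq τ e hzx, mem_annihilator_orbit_iff τ e e' B hτ hB]
    exact hz.2
  obtain ⟨z, hz, hfz, hzx⟩ : ∃ z ∈ N', f z ≠ 0 ∧ z.1 ∈ orbitThrough τ e x := by
    by_contra! H
    obtain ⟨z, hz⟩ := hirr.nonempty
    have := (hO _ (const_mem_polyFun 1) fun z hz h h' => absurd h' (H z hz h)).2 z hz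
    exact one_ne_zero this
  have hle : vanishing (conormal B (orbitThrough τ e x)) ⊆ vanishing N' := fun p hp =>
    hO p hp.1 fun z hz _ hzx => hp.2 z (hsub hz hzx)
  refine ⟨x, hle.antisymm ?_⟩
  -- At the smooth point `z` the two tangent spaces are nested and both of dimension `dim V`, hence
  -- equal.
  refine vanishing_subset_of_tangentSpace_subset (isIrred_conormal τ e e' B hτ hB x) hle
    (hfs z hz hfz) ?_
  have h1 := finrank_tangentSubmodule_conormal τ e e' B hτ hB x (hsub hz hzx)
  have h2 : Module.finrank ℂ (tangentSubmodule N' z) = Module.finrank ℂ V := by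
    obtain ⟨y, hy, rfl⟩ := hz
    rw [hN', dualConormal, finrank_tangentSubmodule_image_equiv,
      finrank_tangentSubmodule_conormal τ e' e B.flip hτ hB' ξ hy]
    exact B.flip.toPerfPair.finrank_eq.trans (Subspace.dual_finrank_eq)
  have := Submodule.eq_of_le_of_finrank_eq
    (show tangentSubmodule N' z ≤ tangentSubmodule _ z from tangentSpace_mono hle z)
    (h2.trans h1.symm)
  exact (SetLike.coe_set_eq.mpr this).ge

end Conormal

/-! ### Irreducibility of connected algebraic groups -/

/-- An irreducible component `Z` meeting `W` lies in the closure of `W`, hence equals it by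
maximality and contains `W`. Components are thus open and closed. -/
theorem irreducibleSpace_of_forall_exists_isOpen {X : Type*} [TopologicalSpace X]
    [ConnectedSpace X] (h : ∀ x : X, ∃ W : Set X, IsOpen W ∧ x ∈ W ∧ IsIrreducible W) :
    IrreducibleSpace X := by
  obtain ⟨x₀⟩ := (inferInstance : Nonempty X)
  set Z := irreducibleComponent x₀
  have hZ : IsOpen Z := by
    rw [isOpen_iff_forall_mem_open]
    intro x hx
    obtain ⟨W, hW, hxW, hirr⟩ := h x
    refine ⟨W, ?_, hW, hxW⟩
    have h1 : Z ⊆ closure W := by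
      refine (subset_closure_inter_of_isPreirreducible_of_isOpen
        (isIrreducible_irreducibleComponent (x := x₀)).isPreirreducible hW ⟨x, hx, hxW⟩).trans ?_
      exact closure_mono Set.inter_subset_right
    have h2 := eq_irreducibleComponent hirr.isPreirreducible.closure h1
    exact subset_closure.trans h2.le
  have huniv : Z = Set.univ :=
    IsClopen.eq_univ ⟨isClosed_irreducibleComponent, hZ⟩ ⟨x₀, mem_irreducibleComponent⟩
  have := isIrreducible_irreducibleComponent (x := x₀)
  rw [show irreducibleComponent x₀ = Set.univ from huniv] at this
  exact (irreducibleSpace_def X).mpr this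

section Group

variable (G : Over (Spec (.of ℂ)))

/-- The complex point of `G` at a closed point. -/
theorem exists_points_apply_eq [LocallyOfFiniteType G.hom] {x : G.left} (hx : IsClosed {x}) :
    ∃ g : Points G, g.left (IsLocalRing.closedPoint ℂ) = x := by
  let p := (pointEquivClosedPoint G.hom).symm ⟨x, hx⟩
  refine ⟨Over.homMk p.1 p.2, ?_⟩
  have := (pointEquivClosedPoint G.hom).apply_symm_apply ⟨x, hx⟩
  exact congr_arg Subtype.val this

-- By noetherianity some nonempty open `W` lies in a single component, so it is irreducible. Every
-- point specializes to a closed one, and right translation by `gy⁻¹ gu` takes that closed point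
-- into `W`, so preimages of `W` are irreducible neighbourhoods of all points.
open CartesianMonoidalCategory in
theorem irreducibleSpace_left [GrpObj G] [LocallyOfFiniteType G.hom] [QuasiCompact G.hom]
    [ConnectedSpace G.left] : IrreducibleSpace G.left := by
  have := LocallyOfFiniteType.jacobsonSpace G.hom
  have : CompactSpace G.left := (quasiCompact_iff_compactSpace (f := G.hom)).mp inferInstance
  have : IsNoetherian G.left := { __ := LocallyOfFiniteType.isLocallyNoetherian G.hom }
  obtain ⟨x₀⟩ := (inferInstance : Nonempty G.left)
  obtain ⟨W, hW, hWne, hWZ⟩ :=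
    TopologicalSpace.NoetherianSpace.exists_isOpen_nonempty_subset_irreducibleComponent (irreducibleComponent x₀) (irreducibleComponent_mem_irreducibleComponents x₀)
  have hWirr : IsIrreducible W :=
    ⟨hWne, fun u v hu hv ⟨a, ha, hau⟩ ⟨b, hb, hbv⟩ => by
      have := (isIrreducible_irreducibleComponent (x := x₀)).isPreirreducible (u ∩ W) (v ∩ W)
        (hu.inter hW) (hv.inter hW) ⟨a, hWZ ha, hau, ha⟩ ⟨b, hWZ hb, hbv, hb⟩
      obtain ⟨c, -, ⟨hcu, hcW⟩, hcv, -⟩ := this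
      exact ⟨c, hcW, hcu, hcv⟩⟩
  obtain ⟨u, huW, hu⟩ := nonempty_inter_closedPoints hWne
    hW.isLocallyClosed
  obtain ⟨gu, rfl⟩ := exists_points_apply_eq G hu
  refine irreducibleSpace_of_forall_exists_isOpen fun x => ?_
  obtain ⟨y, hyx, hy⟩ := nonempty_inter_closedPoints (closure_nonempty_iff.mpr (Set.singleton_nonempty x))
    isClosed_closure.isLocallyClosed
  obtain ⟨gy, rfl⟩ := exists_points_apply_eq G hy
  let α := (GrpObj.mulRight (A := G) gy).symm ≪≫ GrpObj.mulRight (A := G) gu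
  have hα : gy ≫ α.hom = gu := by
    dsimp only [Iso.trans_hom, Iso.symm_hom, α]
    rw [← Category.assoc, ← Iso.eq_comp_inv]
    simp [comp_lift_assoc]
  have hα' : α.hom.left (gy.left (IsLocalRing.closedPoint ℂ)) =
      gu.left (IsLocalRing.closedPoint ℂ) := by
    rw [← hα]; rfl
  have : IsIso α.hom.left := inferInstanceAs (IsIso ((Over.forget _).map α.hom))
  refine ⟨α.hom.left ⁻¹' W, hW.preimage α.hom.left.continuous, ?_, ?_, ?_⟩
  · have ho : IsOpen (α.hom.left ⁻¹' W) := hW.preimage α.hom.left.continuous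
    obtain ⟨z, hz, hzx⟩ := mem_closure_iff.mp hyx _ ho (by rw [Set.mem_preimage, hα']; exact huW)
    rwa [Set.mem_singleton_iff.mp hzx] at hz
  · exact ⟨gy.left (IsLocalRing.closedPoint ℂ), by rw [Set.mem_preimage, hα']; exact huW⟩
  · exact hWirr.isPreirreducible.preimage α.hom.left.isOpenEmbedding

/-- A nonempty affine chart of a connected algebraic group: a domain `A` of finite type whose
complex points are points of the group, such that regular functions on the group that vanish on
the chart vanish. -/
theorem exists_affine_chart [GrpObj G] [LocallyOfFiniteType G.hom] [QuasiCompact G.hom]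
    [ConnectedSpace G.left] :
    ∃ (A : Type) (_ : CommRing A) (_ : IsDomain A) (_ : Algebra ℂ A) (_ : Algebra.FiniteType ℂ A)
      (pt : (A →ₐ[ℂ] ℂ) → Points G) (r : Γ(G.left, ⊤) →+* A),
      (∀ χ s, evalPoint (pt χ) s = χ (r s)) ∧ ∀ s, r s = 0 → ∀ g, evalPoint g s = 0 := by
  have := irreducibleSpace_left G
  obtain ⟨x₀⟩ := (inferInstance : Nonempty G.left)
  obtain ⟨_, ⟨U, hU, rfl⟩, hxU, -⟩ :=
    G.left.isBasis_affineOpens.exists_subset_of_mem_open (Set.mem_univ x₀) isOpen_univ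
  let A₀ := Γ(G.left, U)
  let j : Spec A₀ ⟶ G.left := IsAffineOpen.fromSpec hU
  have hj : IsOpenImmersion j := IsAffineOpen.isOpenImmersion_fromSpec hU
  let c : CommRingCat.of ℂ ⟶ A₀ := Spec.preimage (j ≫ G.hom)
  have hc : Spec.map c = j ≫ G.hom := Spec.map_preimage _
  let : Algebra ℂ A₀ := c.hom.toAlgebra
  have hft : Algebra.FiniteType ℂ A₀ := by
    have : LocallyOfFiniteType (Spec.map c) := by rw [hc]; infer_instance
    exact (HasRingHomProperty.Spec_iff (P := @LocallyOfFiniteType)).mp this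
  have hrange : Set.range j = (U : Set G.left) := hU.range_fromSpec
  have hirr : IsIrreducible (Set.univ : Set (PrimeSpectrum A₀)) := by
    refine ⟨?_, ?_⟩
    · obtain ⟨y, -⟩ : x₀ ∈ Set.range j := hrange ▸ hxU
      exact ⟨y, trivial⟩
    · exact (PreirreducibleSpace.isPreirreducible_univ (X := G.left)).preimage j.isOpenEmbedding
  -- `G` is not assumed reduced: irreducibility makes the nilradical prime, and dividing by it loses
  -- no complex points.
  have hprime : (nilradical A₀).IsPrime := by
    rw [← PrimeSpectrum.vanishingIdeal_univ, ← PrimeSpectrum.isIrreducible_iff_vanishingIdeal_isPrime]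
    exact hirr
  let mk := Ideal.Quotient.mkₐ ℂ (nilradical A₀)
  let θ (χ : (A₀ ⧸ nilradical A₀) →ₐ[ℂ] ℂ) : A₀ ⟶ CommRingCat.of ℂ :=
    CommRingCat.ofHom (χ.comp mk : A₀ →+* ℂ)
  have hθ (χ) : c ≫ θ χ = 𝟙 _ := by
    ext z
    exact (χ.comp mk).commutes z
  let r : Γ(G.left, ⊤) →+* A₀ ⧸ nilradical A₀ :=
    (mk : A₀ →+* A₀ ⧸ nilradical A₀).comp (j.appTop ≫ (Scheme.ΓSpecIso A₀).hom).hom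
  refine ⟨A₀ ⧸ nilradical A₀, inferInstance, inferInstance, inferInstance, inferInstance,
    fun χ => Over.homMk (Spec.map (θ χ) ≫ j) ?_, r, fun χ s => ?_, fun s hs g => ?_⟩
  · change (Spec.map (θ χ) ≫ j) ≫ G.hom = 𝟙 _
    rw [Category.assoc, ← hc, ← Spec.map_comp, hθ, Spec.map_id]
  · change (Scheme.ΓSpecIso (.of ℂ)).hom ((Spec.map (θ χ) ≫ j).appTop s) = _
    have := congr($(Scheme.ΓSpecIso_naturality (θ χ)) (j.appTop s))
    rw [Scheme.Hom.comp_appTop]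
    exact this
  -- A function nilpotent on the chart has empty nonvanishing locus there, hence everywhere, since
  -- nonempty open sets meet.
  · have h1 : IsNilpotent ((Scheme.ΓSpecIso A₀).hom (j.appTop s)) := by
      rw [← mem_nilradical]
      exact Ideal.Quotient.eq_zero_iff_mem.mp hs
    have h2 : IsNilpotent (j.appTop s) := by
      have := h1.map (Scheme.ΓSpecIso A₀).inv.hom
      simpa using this
    have h3 : j ⁻¹ᵁ G.left.basicOpen s = ⊥ := by
      rw [Scheme.preimage_basicOpen_top]
      exact (Scheme.isNilpotent_iff_basicOpen_eq_bot _).mp h2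
    have h4 : G.left.basicOpen s = ⊥ := by
      by_contra hne
      obtain ⟨y, hy⟩ := (TopologicalSpace.Opens.ne_bot_iff_nonempty _).mp hne
      obtain ⟨z, -, hz1, hz2⟩ := (PreirreducibleSpace.isPreirreducible_univ (X := G.left))
        _ _ U.2 (G.left.basicOpen s).2 ⟨x₀, trivial, hxU⟩ ⟨y, trivial, hy⟩
      obtain ⟨z', rfl⟩ : z ∈ Set.range j := hrange ▸ hz1
      have : z' ∈ j ⁻¹ᵁ G.left.basicOpen s := hz2
      rw [h3] at this
      exact this
    have h5 : (Spec (.of ℂ)).basicOpen (g.left.appTop s) = ⊥ := by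
      have := Scheme.preimage_basicOpen_top g.left s
      rw [h4] at this
      exact this.symm
    have h6 : IsNilpotent (g.left.appTop s) := (Scheme.isNilpotent_iff_basicOpen_eq_bot (X := Spec (.of ℂ)) _).mpr h5
    exact (h6.map (Scheme.ΓSpecIso (.of ℂ)).hom.hom).eq_zero

end Group

/-! ### Rational representations -/

section Rational

variable {G : Over (Spec (.of ℂ))}

theorem evalPoint_const (g : Points G) (c : ℂ) :
    evalPoint g (G.hom.appTop ((Scheme.ΓSpecIso (.of ℂ)).inv c)) = c := by
  have h := Over.w g
  have h1 : (G.hom.appTop ≫ g.left.appTop) = 𝟙 _ := by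
    rw [← Scheme.Hom.comp_appTop, h]
    exact Scheme.Hom.id_appTop 
  have h2 := congr($h1 ((Scheme.ΓSpecIso (.of ℂ)).inv c))
  change (Scheme.ΓSpecIso (.of ℂ)).hom ((G.hom.appTop ≫ g.left.appTop) _) = c
  rw [h2]
  simp

variable (G) in
/-- The algebra of functions on the complex points given by global regular functions. -/
def regularFun : Subalgebra ℂ (Points G → ℂ) where
  carrier := {φ | ∃ s : Γ(G.left, ⊤), ∀ g, φ g = evalPoint g s}
  mul_mem' := by
    rintro _ _ ⟨s, hs⟩ ⟨t, ht⟩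
    exact ⟨s * t, fun g => by simp [hs, ht, evalPoint]⟩
  add_mem' := by
    rintro _ _ ⟨s, hs⟩ ⟨t, ht⟩
    exact ⟨s + t, fun g => by simp [hs, ht, evalPoint]⟩
  algebraMap_mem' c := ⟨_, fun g => (evalPoint_const g c).symm⟩

theorem mem_regularFun {φ : Points G → ℂ} :
    φ ∈ regularFun G ↔ ∃ s : Γ(G.left, ⊤), ∀ g, φ g = evalPoint g s := Iff.rfl

variable {W : Type*} [AddCommGroup W] [Module ℂ W]

/-- A map to a vector space is regular if its composites with linear forms are. -/
def IsRegularMap (L : Points G → W) : Prop :=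
  ∀ f : Module.Dual ℂ W, (fun g => f (L g)) ∈ regularFun G

theorem IsRegularMap.comp_mem {L : Points G → W} (hL : IsRegularMap L) {p : W → ℂ}
    (hp : p ∈ polyFun W) : (fun g => p (L g)) ∈ regularFun G := by
  induction hp using Algebra.adjoin_induction with
  | mem x hx =>
    obtain ⟨f, rfl⟩ := hx
    exact hL f
  | algebraMap r => exact (regularFun G).algebraMap_mem r
  | add x y _ _ hx hy => exact (regularFun G).add_mem hx hy
  | mul x y _ _ hx hy => exact (regularFun G).mul_mem hx hy

/-- Matrix coefficients of the dual are those of `ρ` at `g⁻¹`, so they are pulled back along the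
inversion morphism. -/
theorem IsRational.dual [GrpObj G] {V : Type*} [AddCommGroup V] [Module ℂ V] [FiniteDimensional ℂ V]
    {ρ : Representation ℂ (Points G) V} (hρ : IsRational G ρ) : IsRational G ρ.dual := by
  intro φ f
  obtain ⟨v, rfl⟩ := (Module.evalEquiv ℂ V).surjective f
  obtain ⟨s, hs⟩ := hρ v φ
  refine ⟨(ι[G]).left.appTop s, fun g => ?_⟩
  have h1 : (Module.evalEquiv ℂ V v) (ρ.dual g φ) = φ (ρ g⁻¹ v) := rfl
  have h2 : (g⁻¹).left = g.left ≫ (ι[G]).left := rfl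
  rw [h1, hs]
  simp only [evalPoint, h2, Scheme.Hom.comp_appTop]
  rfl

theorem IsRational.isRegularMap [GrpObj G] {V : Type*} [AddCommGroup V] [Module ℂ V] [FiniteDimensional ℂ V]
    {ρ : Representation ℂ (Points G) V} (hρ : IsRational G ρ) : IsRegularMap fun g => ρ g := by
  intro f
  let b := Module.finBasis ℂ V
  have : (fun g => f (ρ g)) = ∑ ij, f (b.end ij) • fun g => b.coord ij.1 (ρ g (b ij.2)) := by
    ext g
    conv_lhs => rw [← b.end.sum_repr (ρ g)]
    simp only [map_sum, map_smul, Finset.sum_apply, Pi.smul_apply, smul_eq_mul]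
    refine Finset.sum_congr rfl fun ij _ => ?_
    rw [mul_comm, Module.Basis.end_repr_apply]
    change _ * LinearMap.toMatrix b b (ρ g) ij.1 ij.2 = _
    rw [LinearMap.toMatrix_apply]
    rfl
  rw [this]
  exact Subalgebra.sum_mem _ fun ij _ => Subalgebra.smul_mem _ (hρ _ _) _

theorem IsRegularMap.prodMk {W' : Type*} [AddCommGroup W'] [Module ℂ W'] {L : Points G → W}
    {L' : Points G → W'} (hL : IsRegularMap L) (hL' : IsRegularMap L') :
    IsRegularMap fun g => (L g, L' g) := by
  intro f
  have : (fun g => f (L g, L' g)) = (fun g => (f ∘ₗ LinearMap.inl ℂ W W') (L g)) +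
      fun g => (f ∘ₗ LinearMap.inr ℂ W W') (L' g) := by
    ext g
    simp [← map_add]
  rw [this]
  exact (regularFun G).add_mem (hL _) (hL' _)

variable [GrpObj G] [LocallyOfFiniteType G.hom] [QuasiCompact G.hom] [ConnectedSpace G.left]

/-- On the affine chart `p` and `q` become elements of a domain, where vanishing is tested at
complex points and propagates to the whole group. -/
theorem IsRegularMap.isIrred {L : Points G → W} (hL : IsRegularMap L) : IsIrred (Set.range L) := by
  obtain ⟨A, _, _, _, _, pt, r, hr, hr0⟩ := exists_affine_chart G
  refine ⟨⟨_, 1, rfl⟩, fun {p q} hp hq hpq => ?_⟩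
  obtain ⟨s, hs⟩ := mem_regularFun.mp (hL.comp_mem hp)
  obtain ⟨t, ht⟩ := mem_regularFun.mp (hL.comp_mem hq)
  have : r s * r t = 0 := eq_zero_of_forall_algHom (k := ℂ) fun χ => by
    rw [map_mul, ← hr, ← hr, ← hs, ← ht]
    exact hpq.2 _ ⟨_, rfl⟩
  refine (mul_eq_zero.mp this).imp (fun h => ⟨hp, ?_⟩) (fun h => ⟨hq, ?_⟩)
  · rintro _ ⟨g, rfl⟩
    exact (hs g).trans (hr0 s h g)
  · rintro _ ⟨g, rfl⟩
    exact (ht g).trans (hr0 t h g)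

/-- Chevalley: the image of a regular map contains a nonempty open subset of its closure. -/
theorem IsRegularMap.exists_mem_range [FiniteDimensional ℂ W] {L : Points G → W}
    (hL : IsRegularMap L) : ∃ p ∈ polyFun W, p ∉ vanishing (Set.range L) ∧
      ∀ w ∈ zariskiClosure (Set.range L), p w ≠ 0 → w ∈ Set.range L := by
  obtain ⟨A, _, _, _, _, pt, r, hr, hr0⟩ := exists_affine_chart G
  choose s hs using fun p : polyFun W => mem_regularFun.mp (hL.comp_mem p.2)
  have hχ (p : polyFun W) (χ : A →ₐ[ℂ] ℂ) : χ (r (s p)) = (p : W → ℂ) (L (pt χ)) := by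
    rw [← hr, ← hs]
  -- The sections `s p` are arbitrary choices; since elements of `A` are determined by their values,
  -- `p ↦ r (s p)` is nevertheless an algebra map.
  have hext {a b : A} (h : ∀ χ : A →ₐ[ℂ] ℂ, χ a = χ b) : a = b := by
    rw [← sub_eq_zero]
    exact eq_zero_of_forall_algHom (k := ℂ) fun χ => by rw [map_sub, h, sub_self]
  let θ : polyFun W →ₐ[ℂ] A := AlgHom.ofLinearMap
    { toFun := fun p => r (s p)
      map_add' := fun p q => hext fun χ => by simp [hχ]
      map_smul' := fun c p => hext fun χ => by simp [hχ] }
    (hext fun χ => by simp [hχ])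
    (fun p q => hext fun χ => by simp [hχ])
  have hθ (p : polyFun W) (χ : A →ₐ[ℂ] ℂ) : χ (θ p) = (p : W → ℂ) (L (pt χ)) := hχ p χ
  have hθ0 (p : polyFun W) : θ p = 0 ↔ (p : W → ℂ) ∈ vanishing (Set.range L) := by
    constructor
    · intro h
      refine ⟨p.2, ?_⟩
      rintro _ ⟨g, rfl⟩
      exact (hs p g).trans (hr0 _ h g)
    · intro h
      exact eq_zero_of_forall_algHom (k := ℂ) fun χ => by rw [hθ]; exact h.2 _ ⟨_, rfl⟩
  have hft : Algebra.FiniteType ℂ θ.range :=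
    Algebra.FiniteType.of_surjective θ.rangeRestrict θ.rangeRestrict_surjective
  -- The range of `θ` is the coordinate ring of the closure of the image. A point `w` of the closure
  -- is a character of it, and where `p w ≠ 0` this character extends to `A`, giving a group element
  -- mapping to `w`.
  obtain ⟨⟨_, p, rfl⟩, hb, H⟩ := exists_ne_zero_forall_algHom_extends ℂ θ.range A
    Subtype.val_injective
  refine ⟨p, p.2, fun h => hb (Subtype.ext ((hθ0 p).mpr h)), fun w hw hpw => ?_⟩
  let ev : polyFun W →ₐ[ℂ] ℂ := (Pi.evalAlgHom ℂ (fun _ : W => ℂ) w).comp (polyFun W).val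
  let ψ : θ.range →ₐ[ℂ] ℂ := (Ideal.Quotient.liftₐ (RingHom.ker θ) ev fun q hq =>
      mem_zariskiClosure.mp hw _ ((hθ0 q).mp hq)).comp
    (Ideal.quotientKerEquivRange θ).symm
  have hψ (q : polyFun W) : ψ ⟨θ q, q, rfl⟩ = (q : W → ℂ) w := by
    have : (Ideal.quotientKerEquivRange θ).symm ⟨θ q, q, rfl⟩ = Ideal.Quotient.mk _ q := by
      rw [AlgEquiv.symm_apply_eq]; rfl
    simp only [ψ, AlgHom.comp_apply, AlgEquiv.coe_toAlgHom, this]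
    rfl
  obtain ⟨χ, hχψ⟩ := H ψ (by
    have := hψ p
    exact fun h => hpw (this.symm.trans h))
  refine ⟨pt χ, ?_⟩
  rw [← sub_eq_zero, ← Module.forall_dual_apply_eq_zero_iff ℂ]
  intro f
  rw [map_sub, sub_eq_zero]
  have h1 := hθ ⟨f, dual_mem_polyFun f⟩ χ
  have h2 := hχψ ⟨θ ⟨f, dual_mem_polyFun f⟩, _, rfl⟩
  rw [hψ] at h2
  exact h1.symm.trans h2

/-- Intersecting closures of images with the same closure. -/
theorem IsRegularMap.inter_nonempty [FiniteDimensional ℂ W] {L L' : Points G → W}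
    (hL : IsRegularMap L) (hL' : IsRegularMap L')
    (h : vanishing (Set.range L) = vanishing (Set.range L')) :
    (Set.range L ∩ Set.range L').Nonempty := by
  obtain ⟨p, hp, hp0, H⟩ := hL.exists_mem_range
  obtain ⟨q, hq, hq0, H'⟩ := hL'.exists_mem_range
  rw [← h] at hq0
  obtain ⟨x, hx, hpx, hqx⟩ : ∃ x ∈ Set.range L, p x ≠ 0 ∧ q x ≠ 0 := by
    by_contra! Hne
    refine (hL.isIrred.eq_zero_or hp hq ⟨(polyFun W).mul_mem hp hq, fun x hx => ?_⟩).elim hp0 hq0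
    by_cases hpx : p x = 0
    · simp [hpx]
    · simp [Hne x hx hpx]
  refine ⟨x, hx, H' x ?_ hqx⟩
  rw [← zariskiClosure_congr h]
  exact subset_zariskiClosure _ hx

end Rational

/-! ### Cones and projective closures -/

section Cone

variable {V : Type*} [AddCommGroup V] [Module ℂ V]

/-- Stability under multiplication by nonzero scalars. -/
def IsConical (C : Set V) : Prop := ∀ c : ℂ, c ≠ 0 → ∀ x ∈ C, c • x ∈ C

theorem IsConical.smul_mem_iff {C : Set V} (hC : IsConical C) {c : ℂ} (hc : c ≠ 0) {x : V} :
    c • x ∈ C ↔ x ∈ C :=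
  ⟨fun h => by simpa [smul_smul, inv_mul_cancel₀ hc] using hC c⁻¹ (inv_ne_zero hc) _ h, hC c hc x⟩

theorem IsConical.zariskiClosure {C : Set V} (hC : IsConical C) :
    IsConical (zariskiClosure C) := fun c hc _ hx _ hp hpC =>
  hx _ (comp_linear_mem_polyFun hp (LinearMap.lsmul ℂ V c)) fun y hy => hpC _ (hC c hc y hy)

/-- The function `t * p (t • x)` vanishes on the whole irreducible line, and `t` does not. -/
theorem IsConical.zero_mem_zariskiClosure {C : Set V} (hC : IsConical C) (hne : C.Nonempty) :
    (0 : V) ∈ PyasetskiiDuality.zariskiClosure C := by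
  obtain ⟨x, hx⟩ := hne
  intro p hp hpC
  have h1 := comp_linear_mem_polyFun hp (LinearMap.toSpanSingleton ℂ V x)
  have h2 : ((LinearMap.id : Module.Dual ℂ ℂ) : ℂ → ℂ) ∈ polyFun ℂ := dual_mem_polyFun _
  rcases isIrred_univ_complex.eq_zero_or h1 h2 ⟨(polyFun ℂ).mul_mem h1 h2, fun t _ => by
    by_cases ht : t = 0
    · simp [ht]
    · simp [LinearMap.toSpanSingleton_apply, hpC _ (hC t ht x hx)]⟩ with h | h
  · simpa using h.2 0 trivial
  · simpa using h.2 1 trivial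

theorem mk_mem_projectivize {C : Set V} (hC : IsConical C) {v : V} (hv : v ≠ 0) :
    Projectivization.mk ℂ v hv ∈ projectivize C ↔ v ∈ C := by
  constructor
  · rintro ⟨w, hw, hwC, h⟩
    obtain ⟨a, rfl⟩ := (Projectivization.mk_eq_mk_iff' ℂ _ _ hw hv).mp h
    refine (hC.smul_mem_iff (c := a) ?_).mp hwC
    rintro rfl
    simp at hw
  · exact fun h => ⟨v, hv, h, rfl⟩

theorem cone_projectivize {C : Set V} (hC : IsConical C) (h0 : (0 : V) ∈ C) :
    cone (projectivize C) = C := by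
  ext v
  by_cases hv : v = 0
  · subst hv
    exact ⟨fun _ => h0, fun _ h => absurd rfl h⟩
  · exact ⟨fun h => (mk_mem_projectivize hC hv).mp (h hv),
      fun h _ => (mk_mem_projectivize hC hv).mpr h⟩

theorem rep_mem_iff {C : Set V} (hC : IsConical C) (x : ℙ ℂ V) :
    x.rep ∈ C ↔ x ∈ projectivize C := by
  rw [← mk_mem_projectivize hC x.rep_nonzero, x.mk_rep]

/-- The component of degree `d` is stored as the coefficient of degree `d` of a polynomial, so that
multiplying functions multiplies the decompositions. -/
theorem exists_homogeneous_decomposition {p : V → ℂ} (hp : p ∈ polyFun V) :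
    ∃ P : Polynomial (V → ℂ), (∀ d, P.coeff d ∈ polyFun V ∧
      ∀ (c : ℂ) (v : V), P.coeff d (c • v) = c ^ d * P.coeff d v) ∧ P.eval 1 = p := by
  induction hp using Algebra.adjoin_induction with
  | mem x hx =>
    obtain ⟨f, rfl⟩ := hx
    refine ⟨Polynomial.monomial 1 (f : V → ℂ), fun d => ?_, by simp⟩
    rw [Polynomial.coeff_monomial]
    split_ifs with h
    · subst h
      exact ⟨dual_mem_polyFun f, by simp⟩
    · exact ⟨(polyFun V).zero_mem, by simp⟩
  | algebraMap r =>
    refine ⟨Polynomial.C (algebraMap ℂ (V → ℂ) r), fun d => ?_, by simp⟩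
    rw [Polynomial.coeff_C]
    split_ifs with h
    · subst h
      exact ⟨(polyFun V).algebraMap_mem r, by simp⟩
    · exact ⟨(polyFun V).zero_mem, by simp⟩
  | add x y _ _ hx hy =>
    obtain ⟨P, hP, rfl⟩ := hx
    obtain ⟨Q, hQ, rfl⟩ := hy
    refine ⟨P + Q, fun d => ?_, by simp⟩
    rw [Polynomial.coeff_add]
    refine ⟨(polyFun V).add_mem (hP d).1 (hQ d).1, fun c v => ?_⟩
    rw [Pi.add_apply, Pi.add_apply, (hP d).2, (hQ d).2, mul_add]
  | mul x y _ _ hx hy =>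
    obtain ⟨P, hP, rfl⟩ := hx
    obtain ⟨Q, hQ, rfl⟩ := hy
    refine ⟨P * Q, fun d => ?_, by simp⟩
    rw [Polynomial.coeff_mul]
    refine ⟨(polyFun V).sum_mem fun i _ => (polyFun V).mul_mem (hP _).1 (hQ _).1, fun c v => ?_⟩
    simp only [Finset.sum_apply, Pi.mul_apply, Finset.mul_sum]
    refine Finset.sum_congr rfl fun i hi => ?_
    rw [(hP _).2, (hQ _).2, ← Finset.HasAntidiagonal.mem_antidiagonal.mp hi, pow_add]
    ring

/-- The homogeneous components of a polynomial function vanishing on a cone vanish on it. -/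
theorem coeff_eq_zero_of_forall_smul {P : Polynomial (V → ℂ)}
    (hP : ∀ d (c : ℂ) (v : V), P.coeff d (c • v) = c ^ d * P.coeff d v) {v : V}
    (h : ∀ c : ℂ, c ≠ 0 → P.eval 1 (c • v) = 0) (d : ℕ) : P.coeff d v = 0 := by
  let φ (x : V) : (V → ℂ) →+* ℂ := Pi.evalRingHom (fun _ : V => ℂ) x
  have key (c : ℂ) : (P.map (φ v)).eval c = P.eval 1 (c • v) := by
    have h1 : P.eval 1 (c • v) = φ (c • v) (P.eval 1) := rfl
    rw [Polynomial.eval_map, Polynomial.eval₂_eq_sum_range, h1, Polynomial.eval_eq_sum_range,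
      map_sum]
    refine Finset.sum_congr rfl fun i _ => ?_
    rw [one_pow, mul_one]
    change P.coeff i v * c ^ i = P.coeff i (c • v)
    rw [hP, mul_comm]
  have h0 : P.map (φ v) = 0 := by
    refine Polynomial.eq_zero_of_infinite_isRoot _ (Set.Infinite.mono (s := {0}ᶜ) ?_ ?_)
    · intro c hc
      exact (key c).trans (h c hc)
    · exact (Set.finite_singleton (0 : ℂ)).infinite_compl
  have := congr_arg (fun Q => Polynomial.coeff Q d) h0
  simpa [φ] using this

/-- Homogeneous components of an equation of a cone are again equations of it, so homogeneous
equations cut out the closure. -/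
theorem projClosure_projectivize {C : Set V} (hC : IsConical C) :
    projClosure (projectivize C) = projectivize (zariskiClosure C) := by
  ext x
  rw [← rep_mem_iff hC.zariskiClosure]
  constructor
  · intro hx p hp hpC
    obtain ⟨P, hP, rfl⟩ := exists_homogeneous_decomposition hp
    have hcoeff (d : ℕ) : P.coeff d x.rep = 0 := by
      refine hx _ (hP d).1 ⟨d, (hP d).2⟩ fun y hy => ?_
      exact coeff_eq_zero_of_forall_smul (fun d => (hP d).2)
        (fun c hc => hpC _ (hC c hc _ ((rep_mem_iff hC y).mpr hy))) d
    have := Polynomial.eval_eq_sum_range (p := P) (1 : V → ℂ)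
    rw [this, Finset.sum_apply]
    exact Finset.sum_eq_zero fun i _ => by simp [hcoeff]
  · intro hx p hp ⟨d, hd⟩ hpC
    refine hx p hp ?_
    have hne : ∀ y ∈ C, y ≠ 0 → p y = 0 := by
      intro y hy hy0
      obtain ⟨a, ha⟩ := Projectivization.exists_smul_eq_mk_rep ℂ y hy0
      have h1 := hpC _ ((mk_mem_projectivize hC hy0).mpr hy)
      rw [← ha, Units.smul_def, hd] at h1
      exact (mul_eq_zero.mp h1).resolve_left (pow_ne_zero _ a.ne_zero)
    -- A nonzero point of `C` is needed for vanishing at the origin, which is not automatic in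
    -- degree `0`.
    obtain ⟨y, hy, hy0⟩ : ∃ y ∈ C, y ≠ 0 := by
      by_contra! H
      refine x.rep_nonzero ?_
      rw [← Module.forall_dual_apply_eq_zero_iff ℂ]
      exact fun f => hx f (dual_mem_polyFun f) fun y hy => by rw [H y hy, map_zero]
    intro z hz
    by_cases hz0 : z = 0
    · have := hd 0 y
      rw [hne y hy hy0, mul_zero, zero_smul] at this
      rw [hz0, this]
    · exact hne z hz hz0

theorem projectivize_eq_iff {C C' : Set V} (hC : IsConical C) (h0 : (0 : V) ∈ C)
    (hC' : IsConical C') (h0' : (0 : V) ∈ C') : projectivize C = projectivize C' ↔ C = C' :=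
  ⟨fun h => by rw [← cone_projectivize hC h0, h, cone_projectivize hC' h0'], fun h => by rw [h]⟩

/-- If a group acts linearly with finitely many orbits, the orbits are cones: the stabilizer of an
orbit in the divisible group of scalars has finite index. -/
theorem isConical_of_finite_orbits {Γ : Type*} [Group Γ] (ρ : Representation ℂ Γ V)
    (hfin : (orbits ρ).Finite) {O : Set V} (hO : O ∈ orbits ρ) : IsConical O := by
  obtain ⟨v, rfl⟩ := hO
  have hmul (g h : Γ) (x : V) : ρ g (ρ h x) = ρ (g * h) x := by rw [map_mul]; rfl
  let S : Subgroup ℂˣ :=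
    { carrier := {a | ∃ g, ρ g v = a • v}
      mul_mem' := by
        rintro a b ⟨g, hg⟩ ⟨h, hh⟩
        refine ⟨g * h, ?_⟩
        rw [← hmul, hh, Units.smul_def, map_smul, hg, ← Units.smul_def, smul_smul, mul_comm]
      one_mem' := ⟨1, by simp⟩
      inv_mem' := by
        rintro a ⟨g, hg⟩
        refine ⟨g⁻¹, ?_⟩
        rw [eq_inv_smul_iff, Units.smul_def, ← map_smul, ← Units.smul_def, ← hg, hmul,
          inv_mul_cancel, map_one]
        rfl }
  -- The coset of `a` is sent to the orbit of `a • v`; this is well defined and injective.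
  have : Finite (ℂˣ ⧸ S) := by
    have := hfin.to_subtype
    refine Finite.of_injective (β := orbits ρ) (Quotient.lift
      (fun a : ℂˣ => (⟨Set.range fun g => ρ g (a • v), a • v, rfl⟩ : orbits ρ)) ?_) ?_
    · intro a b hab
      obtain ⟨k, hk⟩ := QuotientGroup.leftRel_apply.mp hab
      have hb : b • v = ρ k (a • v) := by
        rw [Units.smul_def a, map_smul, hk, ← Units.smul_def, smul_smul, mul_inv_cancel_left]
      refine Subtype.ext (Set.Subset.antisymm ?_ ?_)
      · rintro _ ⟨g, rfl⟩
        refine ⟨g * k⁻¹, ?_⟩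
        simp only [hb, hmul, inv_mul_cancel_right]
      · rintro _ ⟨g, rfl⟩
        refine ⟨g * k, ?_⟩
        simp only [hb, hmul]
    · intro a b
      refine Quotient.inductionOn₂ a b fun a b hab => ?_
      refine Quotient.sound (QuotientGroup.leftRel_apply.mpr ?_)
      have h1 : (Set.range fun g => ρ g (a • v)) = Set.range fun g => ρ g (b • v) :=
        congr_arg Subtype.val hab
      have h2 : b • v ∈ Set.range fun g => ρ g (a • v) := by
        have : b • v ∈ Set.range fun g => ρ g (b • v) := ⟨1, by simp⟩
        rwa [h1]
      obtain ⟨g, hg⟩ := h2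
      refine ⟨g, ?_⟩
      simp only [Units.smul_def a, map_smul] at hg
      rw [mul_smul, ← hg, eq_inv_smul_iff, Units.smul_def]
  rintro c hc _ ⟨g, rfl⟩
  have hn : S.index ≠ 0 := Subgroup.index_ne_zero_of_finite
  obtain ⟨z, hz⟩ := IsAlgClosed.exists_pow_nat_eq c (Nat.pos_of_ne_zero hn)
  have hz0 : z ≠ 0 := by
    rintro rfl
    rw [zero_pow hn] at hz
    exact hc hz.symm
  obtain ⟨h, hh⟩ := Subgroup.pow_index_mem S (Units.mk0 z hz0)
  refine ⟨g * h, ?_⟩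
  simp only
  rw [← hmul, hh, Units.smul_def, map_smul]
  simp [hz]

end Cone

/-! ### The dual variety of an irreducible cone -/

section DualVariety

variable {V : Type*} [AddCommGroup V] [Module ℂ V] [FiniteDimensional ℂ V]

/-- A linear form that is conormal to `Y` at `v` is the differential of an equation of `Y`. -/
theorem exists_differential_eq {Y : Set V} {v : V} {ξ : Module.Dual ℂ V}
    (h : ∀ w ∈ tangentSpace Y v, ξ w = 0) :
    ∃ q, ∃ hq : q ∈ polyFun V, q ∈ vanishing Y ∧ differential hq v = ξ := by
  let S : Submodule ℂ (Module.Dual ℂ V) :=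
    { carrier := {ζ | ∃ q, ∃ hq : q ∈ polyFun V, q ∈ vanishing Y ∧ differential hq v = ζ}
      zero_mem' := by
        have h0 := (polyFun V).zero_mem
        refine ⟨0, h0, ⟨h0, fun _ _ => rfl⟩, ?_⟩
        ext w
        rw [differential_apply]
        exact (hasDerivAt_const (0 : ℂ) (0 : ℂ)).deriv
      add_mem' := by
        rintro _ _ ⟨q, hq, hqY, rfl⟩ ⟨r, hr, hrY, rfl⟩
        have hm := (polyFun V).add_mem hq hr
        refine ⟨_, hm, ⟨hm, fun x hx => ?_⟩, ?_⟩
        · rw [Pi.add_apply, hqY.2 x hx, hrY.2 x hx, add_zero]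
        · ext w
          rw [differential_apply, lineDeriv_polyFun_add hq hr, LinearMap.add_apply,
            differential_apply, differential_apply]
      smul_mem' := by
        rintro c _ ⟨q, hq, hqY, rfl⟩
        have hc := const_mem_polyFun (V := V) c
        have hm := (polyFun V).mul_mem hc hq
        refine ⟨_, hm, ⟨hm, fun x hx => ?_⟩, ?_⟩
        · rw [Pi.mul_apply, hqY.2 x hx, mul_zero]
        · ext w
          have h0 : lineDeriv ℂ (fun _ : V => c) v w = 0 := (hasDerivAt_const (0 : ℂ) c).deriv
          rw [differential_apply, lineDeriv_polyFun_mul hc hq, h0, zero_mul, add_zero,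
            LinearMap.smul_apply, differential_apply, smul_eq_mul] }
  change ξ ∈ S
  -- The common kernel of the differentials in `S` is the tangent space, and in finite dimension `S`
  -- contains every form that kills its common kernel.
  rw [← Subspace.dualCoannihilator_dualAnnihilator_eq (W := S), Submodule.mem_dualAnnihilator]
  intro w hw
  refine h w fun p hp hpY => ?_
  rw [← differential_apply hp]
  exact (Submodule.mem_dualCoannihilator _).mp hw _ ⟨p, hp, ⟨hp, hpY⟩, rfl⟩

/-- Conormal vectors at the points of a dense subset are dense among all conormal vectors. -/
theorem eq_zero_of_dense {Y D : Set V} (hD : ∀ q ∈ polyFun V, (∀ x ∈ D, q x = 0) → q ∈ vanishing Y)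
    {p : Module.Dual ℂ V → ℂ} (hp : p ∈ polyFun (Module.Dual ℂ V))
    (h : ∀ v ∈ D, ∀ ξ : Module.Dual ℂ V, (∀ w ∈ tangentSpace Y v, ξ w = 0) → p ξ = 0)
    {v : V} (hv : v ∈ zariskiClosure Y) {ξ : Module.Dual ℂ V}
    (hξ : ∀ w ∈ tangentSpace Y v, ξ w = 0) : p ξ = 0 := by
  -- The differential of `q` extends `ξ` to a polynomial family of conormal vectors, and `p` along
  -- this family vanishes on `D`, hence at `v`.
  obtain ⟨q, hq, hqY, rfl⟩ := exists_differential_eq hξ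
  have hmem : (fun x => p (differential hq x)) ∈ polyFun V := by
    clear h
    induction hp using Algebra.adjoin_induction with
    | mem x hx =>
      obtain ⟨f, rfl⟩ := hx
      obtain ⟨w, rfl⟩ := (Module.evalEquiv ℂ V).surjective f
      simp only [Module.evalEquiv_apply, Module.Dual.eval_apply, differential_apply]
      exact lineDeriv_mem_polyFun hq w
    | algebraMap r => exact const_mem_polyFun r
    | add x y _ _ hx hy => exact (polyFun V).add_mem hx hy
    | mul x y _ _ hx hy => exact (polyFun V).mul_mem hx hy
  refine mem_zariskiClosure.mp hv _ (hD _ hmem fun x hx => h x hx _ fun w hw => ?_)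
  rw [differential_apply]
  exact mem_tangentSpace.mp hw q hqY

/-- The dual variety uses conormal vectors at smooth nonzero points of the closure, the conormal
bundle those at points of `O`. Both sets are dense in the closure, so `eq_zero_of_dense`, applied in
each direction, gives the same equations. -/
theorem IsIrred.dualVariety_eq {O : Set V} (hO : IsIrred O) (hC : IsConical O)
    (hne : (projectivize (zariskiClosure O)).Nonempty) :
    dualVariety (projectivize (zariskiClosure O)) =
      projectivize (zariskiClosure (Prod.snd '' conormal (Module.Dual.eval ℂ V) O)) := by
  set Y := zariskiClosure O with hY
  have hYO : vanishing Y = vanishing O := vanishing_zariskiClosure O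
  have hYirr : IsIrred Y := hO.congr hYO.symm
  have hcone : cone (projectivize Y) = Y :=
    cone_projectivize hC.zariskiClosure (hC.zero_mem_zariskiClosure hO.nonempty)
  obtain ⟨_, y, hy0, hyY, rfl⟩ := hne
  obtain ⟨l, hl⟩ : ∃ l : Module.Dual ℂ V, l y ≠ 0 := by
    by_contra! H
    exact hy0 ((Module.forall_dual_apply_eq_zero_iff ℂ y).mp H)
  obtain ⟨f, hf, hf0, hfs⟩ := exists_forall_isSmoothPoint hYirr
  let D : Set V := {v | v ≠ 0 ∧ IsSmoothPoint Y v}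
  have hD : ∀ q ∈ polyFun V, (∀ x ∈ D, q x = 0) → q ∈ vanishing Y := by
    intro q hq hqD
    have h1 := (polyFun V).mul_mem hf (dual_mem_polyFun l)
    have h2 : f * l ∉ vanishing Y := fun h =>
      (hYirr.eq_zero_or hf (dual_mem_polyFun l) h).elim hf0 fun h => hl (h.2 y hyY)
    refine (hYirr.eq_zero_or hq h1 ⟨(polyFun V).mul_mem hq h1, fun x hx => ?_⟩).resolve_right h2
    by_cases hx' : f x = 0 ∨ l x = 0
    · rcases hx' with h | h <;> simp [h]
    · push Not at hx'
      rw [Pi.mul_apply, hqD x ⟨?_, hfs x hx hx'.1⟩, zero_mul]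
      rintro rfl
      exact hx'.2 (map_zero l)
  let C : Set (Module.Dual ℂ V) := {ξ | ∃ v ∈ D, ∀ w ∈ tangentSpace Y v, ξ w = 0}
  have hCC : IsConical C := by
    rintro c hc ξ ⟨v, hv, h⟩
    exact ⟨v, hv, fun w hw => by rw [LinearMap.smul_apply, h w hw, smul_zero]⟩
  have hT : {H | IsTangentHyperplane (projectivize Y) H} = projectivize C := by
    ext H
    rw [← rep_mem_iff hCC, Set.mem_ofPred_eq, IsTangentHyperplane, hcone]
    constructor
    · rintro ⟨v, hv0, hv, h⟩
      refine ⟨v, ⟨hv0, hv⟩, h _ ?_⟩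
      rw [Projectivization.submodule_eq]
      exact Submodule.mem_span_singleton_self _
    · rintro ⟨v, ⟨hv0, hv⟩, h⟩
      refine ⟨v, hv0, hv, fun ξ hξ w hw => ?_⟩
      rw [Projectivization.submodule_eq, Submodule.mem_span_singleton] at hξ
      obtain ⟨a, rfl⟩ := hξ
      rw [LinearMap.smul_apply, h w hw, smul_zero]
  rw [dualVariety, hT, projClosure_projectivize hCC]
  congr 1
  refine zariskiClosure_congr (Set.Subset.antisymm ?_ ?_)
  · intro p hp
    refine ⟨hp.1, ?_⟩
    rintro _ ⟨⟨v, ξ⟩, hz, rfl⟩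
    refine eq_zero_of_dense hD hp.1 (fun v hv ξ hξ => hp.2 ξ ⟨v, hv, hξ⟩) (v := v) ?_ ?_
    · exact subset_zariskiClosure _ (subset_zariskiClosure _ hz.1)
    · rw [tangentSpace_congr hYO]
      exact hz.2
  · intro p hp
    refine ⟨hp.1, ?_⟩
    rintro ξ ⟨v, hv, hξ⟩
    refine eq_zero_of_dense (Y := Y) (D := O) (fun q hq hqO => ?_) hp.1 ?_
      (subset_zariskiClosure _ hv.2.choose) hξ
    · rw [hYO]; exact ⟨hq, hqO⟩
    · intro v hv ξ hξ
      rw [tangentSpace_congr hYO] at hξ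
      exact hp.2 _ ⟨(v, ξ), ⟨hv, hξ⟩, rfl⟩

/-- In the exceptional case `O = {0}` has zero tangent space, so every form is conormal, in
agreement with the convention for the empty set. -/
theorem IsIrred.isProjectivelyDual_iff {O : Set V} (hO : IsIrred O) (hC : IsConical O)
    (X' : Set (ℙ ℂ (Module.Dual ℂ V))) :
    IsProjectivelyDual (projectivize (zariskiClosure O)) X' ↔
      projectivize (zariskiClosure (Prod.snd '' conormal (Module.Dual.eval ℂ V) O)) = X' := by
  rcases (projectivize (zariskiClosure O)).eq_empty_or_nonempty with h | h
  · have hzero : ∀ x ∈ O, x = 0 := by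
      intro x hx
      by_contra hx0
      have : Projectivization.mk ℂ x hx0 ∈ projectivize (zariskiClosure O) :=
        ⟨x, hx0, subset_zariskiClosure _ hx, rfl⟩
      rw [h] at this
      exact this
    have huniv : Prod.snd '' conormal (Module.Dual.eval ℂ V) O = Set.univ := by
      rw [Set.eq_univ_iff_forall]
      intro ξ
      obtain ⟨x, hx⟩ := hO.nonempty
      refine ⟨(x, ξ), ⟨hx, fun w hw => ?_⟩, rfl⟩
      have hw0 : w = 0 := by
        rw [← Module.forall_dual_apply_eq_zero_iff ℂ]
        intro f
        rw [← lineDeriv_dual f x w]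
        exact hw f (dual_mem_polyFun f) fun y hy => by rw [hzero y hy, map_zero]
      rw [hw0, map_zero, LinearMap.zero_apply]
    have hP : projectivize (zariskiClosure (Set.univ : Set (Module.Dual ℂ V))) = Set.univ := by
      rw [Set.eq_univ_iff_forall]
      exact fun x => ⟨x.rep, x.rep_nonzero, subset_zariskiClosure _ trivial, x.mk_rep⟩
    rw [huniv, hP, h, IsProjectivelyDual]
    simp [eq_comm]
  · rw [← hO.dualVariety_eq hC h, IsProjectivelyDual]
    simp [h, h.ne_empty]

end DualVariety

/-! ### Recovering orbits from conormal bundles, and exchanging the two factors. -/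

section ConormalClosure

variable {V U : Type*} [AddCommGroup V] [Module ℂ V] [AddCommGroup U] [Module ℂ U]

theorem vanishing_image_congr {M N : Set V} (h : vanishing M = vanishing N) (l : V →ₗ[ℂ] U) :
    vanishing (l '' M) = vanishing (l '' N) := by
  have key {M N : Set V} (h : vanishing M = vanishing N) :
      vanishing (l '' M) ⊆ vanishing (l '' N) := by
    intro p hp
    refine ⟨hp.1, ?_⟩
    rintro _ ⟨x, hx, rfl⟩
    have : (fun x => p (l x)) ∈ vanishing M :=
      ⟨comp_linear_mem_polyFun hp.1 l, fun y hy => hp.2 _ ⟨y, hy, rfl⟩⟩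
    rw [h] at this
    exact this.2 x hx
  exact (key h).antisymm (key h.symm)

theorem fst_image_conormal (B : V →ₗ[ℂ] U →ₗ[ℂ] ℂ) (O : Set V) :
    LinearMap.fst ℂ V U '' conormal B O = O := by
  ext x
  constructor
  · rintro ⟨z, hz, rfl⟩
    exact hz.1
  · exact fun hx => ⟨(x, 0), ⟨hx, Submodule.zero_mem _⟩, rfl⟩

theorem snd_image_dualConormal (B : V →ₗ[ℂ] U →ₗ[ℂ] ℂ) (O : Set U) :
    LinearMap.snd ℂ V U '' dualConormal B O = O := by
  ext x
  constructor
  · rintro ⟨z, hz, rfl⟩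
    exact (mem_dualConormal.mp hz).1
  · exact fun hx => ⟨(0, x), mem_dualConormal.mpr ⟨hx, Submodule.zero_mem _⟩, rfl⟩

/-- This transports to `B` the existence result applied to `B.flip`, with the roles of the two
spaces exchanged. -/
theorem vanishing_dualConormal_eq {B : V →ₗ[ℂ] U →ₗ[ℂ] ℂ} {O : Set V} {O' : Set U}
    (h : vanishing (conormal B.flip O') = vanishing (dualConormal B.flip O)) :
    vanishing (conormal B O) = vanishing (dualConormal B O') := by
  have h1 := vanishing_image_congr h (LinearEquiv.prodComm ℂ U V : U × V →ₗ[ℂ] V × U)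
  have h2 : (LinearEquiv.prodComm ℂ U V : U × V →ₗ[ℂ] V × U) '' dualConormal B.flip O =
      conormal B O := by
    ext z
    constructor
    · rintro ⟨_, ⟨y, hy, rfl⟩, rfl⟩
      exact hy
    · exact fun hz => ⟨z.swap, ⟨z, hz, rfl⟩, rfl⟩
  rw [h2] at h1
  exact h1.symm

end ConormalClosure

end PyasetskiiDuality

/-! ### The bijection of orbits. -/

open PyasetskiiDuality in
theorem corollary2p9
    {V : Type*} [AddCommGroup V] [Module ℂ V] [FiniteDimensional ℂ V]
    (G : Over (Spec (.of ℂ))) [GrpObj G] [LocallyOfFiniteType G.hom] [QuasiCompact G.hom]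
    [ConnectedSpace G.left]
    (ρ : Representation ℂ (Points G) V) (hρ : IsRational G ρ)
    (hfin : (orbits ρ).Finite) :
    (orbits ρ.dual).Finite ∧
    (orbits ρ.dual).ncard = (orbits ρ).ncard ∧
    ∃ e : orbits ρ ≃ orbits ρ.dual,
      ∀ (O : orbits ρ) (O' : orbits ρ.dual),
        e O = O' ↔
          IsProjectivelyDual (projectivize (zariskiClosure (O : Set V)))
            (projectivize (zariskiClosure (O' : Set (Module.Dual ℂ V)))) := by
  let τ : Points G →* Module.End ℂ V × Module.End ℂ (Module.Dual ℂ V) := MonoidHom.prod ρ ρ.dual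
  let e₁ := AlgHom.fst ℂ (Module.End ℂ V) (Module.End ℂ (Module.Dual ℂ V))
  let e₂ := AlgHom.snd ℂ (Module.End ℂ V) (Module.End ℂ (Module.Dual ℂ V))
  let B := Module.Dual.eval ℂ V
  have hτ : IsIrred (Set.range τ) :=
    (hρ.isRegularMap.prodMk hρ.dual.isRegularMap).isIrred
  have hB : ∀ g x ξ, B (e₁ (τ g) x) (e₂ (τ g) ξ) = B x ξ := by
    intro g x ξ
    change ξ (ρ g⁻¹ (ρ g x)) = ξ x
    rw [Representation.inv_self_apply]
  -- Each orbit contains a nonempty open subset of its closure, so two orbits with the same closure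
  -- meet and coincide.
  have huniq {O O₁ : Set V} (hO : O ∈ orbits ρ) (hO₁ : O₁ ∈ orbits ρ)
      (h : vanishing O = vanishing O₁) : O = O₁ := by
    obtain ⟨x, rfl⟩ := hO
    obtain ⟨y, rfl⟩ := hO₁
    have hr (z : V) : IsRegularMap fun g => ρ g z := fun f => hρ z f
    obtain ⟨z, hz, hz'⟩ := (hr x).inter_nonempty (hr y) h
    exact (orbitThrough_eq τ e₁ hz).symm.trans (orbitThrough_eq τ e₁ hz')
  have huniq' {O O₁ : Set (Module.Dual ℂ V)} (hO : O ∈ orbits ρ.dual) (hO₁ : O₁ ∈ orbits ρ.dual)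
      (h : vanishing O = vanishing O₁) : O = O₁ := by
    obtain ⟨x, rfl⟩ := hO
    obtain ⟨y, rfl⟩ := hO₁
    have hr (z : Module.Dual ℂ V) : IsRegularMap fun g => ρ.dual g z := fun f => hρ.dual z f
    obtain ⟨z, hz, hz'⟩ := (hr x).inter_nonempty (hr y) h
    exact (orbitThrough_eq τ e₂ hz).symm.trans (orbitThrough_eq τ e₂ hz')
  have hexists : ∀ O' : orbits ρ.dual, ∃ O : orbits ρ,
      vanishing (conormal B O) = vanishing (dualConormal B (O' : Set (Module.Dual ℂ V))) := by
    rintro ⟨_, ξ, rfl⟩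
    obtain ⟨x, hx⟩ := exists_vanishing_conormal_eq τ e₁ e₂ B hτ hB hfin ξ
    exact ⟨⟨_, x, rfl⟩, hx⟩
  have hunique {O O₁ : orbits ρ} (h : vanishing (conormal B O) = vanishing (conormal B O₁)) :
      O = O₁ := by
    have := vanishing_image_congr h (LinearMap.fst ℂ V (Module.Dual ℂ V))
    rw [fst_image_conormal, fst_image_conormal] at this
    exact Subtype.ext (huniq O.2 O₁.2 this)
  have hunique' {O O₁ : orbits ρ.dual} (h : vanishing (dualConormal B (O : Set (Module.Dual ℂ V))) =
      vanishing (dualConormal B (O₁ : Set (Module.Dual ℂ V)))) : O = O₁ := by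
    have := vanishing_image_congr h (LinearMap.snd ℂ V (Module.Dual ℂ V))
    rw [snd_image_dualConormal, snd_image_dualConormal] at this
    exact Subtype.ext (huniq' O.2 O₁.2 this)
  choose b hb using hexists
  -- Injectivity of `b` gives finiteness on the dual side, the hypothesis needed to construct its
  -- inverse by the symmetric argument.
  have hfin' : (orbits ρ.dual).Finite := by
    have := hfin.to_subtype
    have : Finite (orbits ρ.dual) :=
      Finite.of_injective b fun O O₁ h => hunique' (by rw [← hb, ← hb, h])
    exact Set.toFinite _
  have hexists' : ∀ O : orbits ρ, ∃ O' : orbits ρ.dual,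
      vanishing (conormal B O) = vanishing (dualConormal B (O' : Set (Module.Dual ℂ V))) := by
    rintro ⟨_, x, rfl⟩
    obtain ⟨ξ, hξ⟩ := exists_vanishing_conormal_eq τ e₂ e₁ B.flip hτ (fun g ξ x => hB g x ξ) hfin' x
    exact ⟨⟨_, ξ, rfl⟩, vanishing_dualConormal_eq hξ⟩
  choose a ha using hexists'
  let e : orbits ρ ≃ orbits ρ.dual :=
    { toFun := a
      invFun := b
      left_inv := fun O => hunique ((hb _).trans (ha O).symm)
      right_inv := fun O' => hunique' ((ha _).symm.trans (hb O')) }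
  refine ⟨hfin', (Set.ncard_congr' e).symm, e, fun O O' => ?_⟩
  have hOirr : IsIrred (O : Set V) := by
    obtain ⟨_, x, rfl⟩ := O
    exact IsRegularMap.isIrred (L := fun g => ρ g x) fun f => hρ x f
  have hcone (O' : orbits ρ.dual) : IsConical (O' : Set (Module.Dual ℂ V)) :=
    isConical_of_finite_orbits ρ.dual hfin' O'.2
  have hne (O' : orbits ρ.dual) : (O' : Set (Module.Dual ℂ V)).Nonempty := by
    obtain ⟨_, ξ, rfl⟩ := O'
    exact ⟨_, 1, rfl⟩
  -- The second projection of the common conormal closure identifies the cone over the dual variety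
  -- with the closure of the orbit `e O`.
  have hsnd : zariskiClosure (Prod.snd '' conormal B (O : Set V)) =
      zariskiClosure (e O : Set (Module.Dual ℂ V)) := by
    have := vanishing_image_congr (ha O) (LinearMap.snd ℂ V (Module.Dual ℂ V))
    rw [snd_image_dualConormal] at this
    exact zariskiClosure_congr this
  rw [hOirr.isProjectivelyDual_iff (isConical_of_finite_orbits ρ hfin O.2), hsnd,
    projectivize_eq_iff (hcone _).zariskiClosure ((hcone _).zero_mem_zariskiClosure (hne _))
      (hcone _).zariskiClosure ((hcone _).zero_mem_zariskiClosure (hne _)), zariskiClosure_eq_iff]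
  exact ⟨fun h => by rw [h], fun h => Subtype.ext (huniq' (e O).2 O'.2 h)⟩
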